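/- All manifolds are smooth, connected, Hausdorff and second countable. Let $\mathcal H$ be a finite-dimensional manifold with smooth metric hypersurface data $\{\mathcal H,\boldsymbol\gamma,\boldsymbol\ell,\ell^{(2)}\}$: a symmetric $(0,2)$-tensor field $\boldsymbol\gamma$, a one-form $\boldsymbol\ell$ and a function $\ell^{(2)}$ on $\mathcal H$ such that at every $p\in\mathcal H$ the symmetric bilinear form $$\mathcal A\big((W,a),(V,b)\big)=\boldsymbol\gamma(W,V)+a\,\boldsymbol\ell(V)+b\,\boldsymbol\ell(W)+ab\,\ell^{(2)}$$ on $T_p\mathcal H\times\mathbb R$ is non-degenerate. Assume that the data is null, that is, $n^{(2)}=0$ at every $p$, where $(n,n^{(2)})\in T_p\mathcal H\times\mathbb R$ is the unique vector with $\mathcal A\big((n,n^{(2)}),(V,b)\big)=b$ for all $(V,b)$. Let $\{\mathbb Y^{(k)}\}_{k\ge1}$ be any sequence of smooth symmetric $(0,2)$-tensor fields on $\mathcal H$. Then there exist a semi-Riemannian manifold $(\mathcal M,g)$ with $\dim\mathcal M=\dim\mathcal H+1$, whose smooth metric $g$ has a constant signature $(p,q)$ with $p,q\neq0$, a smooth embedding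 $\Phi:\mathcal H\hookrightarrow\mathcal M$, and a smooth vector field $\xi$ on $\mathcal M$, everywhere transversal to $\Phi(\mathcal H)$ along $\Phi(\mathcal H)$ and with $\nabla_\xi\xi=0$ on all of $\mathcal M$ ($\nabla$ the Levi-Civita connection of $g$), such that (i) $\{\mathcal H,\boldsymbol\gamma,\boldsymbol\ell,\ell^{(2)}\}$ is $(\Phi,\xi)$-embedded in $(\mathcal M,g)$: $\Phi^\star g=\boldsymbol\gamma$, $\Phi^\star\big(g(\xi,\cdot)\big)=\boldsymbol\ell$ and $\Phi^\star\big(g(\xi,\xi)\big)=\ell^{(2)}$; (ii) $\tfrac12\Phi^\star\big(\mathcal L_\xi^{(k)}g\big)=\mathbb Y^{(k)}$ for every $k\ge1$, where $\mathcal L_\xi^{(k)}$ denotes the $k$-fold Lie derivative along $\xi$. (No convergence of any series formed from the $\mathbb Y^{(k)}$ is assumed.) -/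

import Mathlib

open Bundle
open scoped Manifold ContDiff

universe u v

noncomputable section

/-! ### Tensor fields on a manifold modelled on a finite-dimensional real vector space `E` -/

section Tensors

variable {E : Type*} [NormedAddCommGroup E] [NormedSpace ℝ E]
  {M : Type*} [TopologicalSpace M] [ChartedSpace E M]

variable (E M) in
/-- Vector fields on `M` (no regularity required). -/
abbrev VectField : Type _ := (x : M) → TangentSpace 𝓘(ℝ, E) x

variable (E M) in
/-- One-forms on `M` (no regularity required). -/
abbrev OneForm : Type _ := (x : M) → (TangentSpace 𝓘(ℝ, E) x →L[ℝ] ℝ)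

variable (E M) in
/-- `(0,2)`-tensor fields on `M` (no regularity required). -/
abbrev Tensor02 : Type _ :=
  (x : M) → (TangentSpace 𝓘(ℝ, E) x →L[ℝ] TangentSpace 𝓘(ℝ, E) x →L[ℝ] ℝ)

/-- The tensor field as a map into the total space of the bundle `Hom(TM, Hom(TM, ℝ))`. -/
abbrev Tensor02.toTotal (T : Tensor02 E M) (x : M) :
    TotalSpace (E →L[ℝ] E →L[ℝ] ℝ)
      (fun x : M ↦ TangentSpace 𝓘(ℝ, E) x →L[ℝ] TangentSpace 𝓘(ℝ, E) x →L[ℝ] ℝ) :=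
  TotalSpace.mk' (E →L[ℝ] E →L[ℝ] ℝ) x (T x)

/-- Smooth `(0,2)`-tensor fields. -/
def Tensor02.IsSmooth [IsManifold 𝓘(ℝ, E) ∞ M] (T : Tensor02 E M) : Prop :=
  ContMDiff 𝓘(ℝ, E) (𝓘(ℝ, E).prod 𝓘(ℝ, E →L[ℝ] E →L[ℝ] ℝ)) ∞ T.toTotal

/-- Symmetric `(0,2)`-tensor fields. -/
def Tensor02.IsSymm (T : Tensor02 E M) : Prop := ∀ x v w, T x v w = T x w v

/-- Smooth one-forms. -/
def OneForm.IsSmooth [IsManifold 𝓘(ℝ, E) ∞ M] (α : OneForm E M) : Prop :=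
  ContMDiff 𝓘(ℝ, E) (𝓘(ℝ, E).prod 𝓘(ℝ, E →L[ℝ] ℝ)) ∞
    (fun x ↦ (TotalSpace.mk' (E →L[ℝ] ℝ) x (α x) :
      TotalSpace (E →L[ℝ] ℝ) (fun x : M ↦ TangentSpace 𝓘(ℝ, E) x →L[ℝ] ℝ)))

/-- Smooth vector fields. -/
def VectField.IsSmooth [IsManifold 𝓘(ℝ, E) ∞ M] (X : VectField E M) : Prop :=
  ContMDiff 𝓘(ℝ, E) (𝓘(ℝ, E).prod 𝓘(ℝ, E)) ∞
    (fun x ↦ (TotalSpace.mk' E x (X x) : TotalSpace E (TangentSpace 𝓘(ℝ, E) : M → Type _)))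

/-- The scalar function `T(X, Y)`. -/
def Tensor02.eval (T : Tensor02 E M) (X Y : VectField E M) (x : M) : ℝ := T x (X x) (Y x)

end Tensors

/-! ### The Lie derivative of a `(0,2)`-tensor field -/

section LieDerivative

variable {E : Type*} [NormedAddCommGroup E] [NormedSpace ℝ E] [FiniteDimensional ℝ E]
  {M : Type*} [TopologicalSpace M] [ChartedSpace E M] [IsManifold 𝓘(ℝ, E) ∞ M]

/-- `ξ(T(X, Y)) - T([ξ, X], Y) - T(X, [ξ, Y])`. -/
def lieDerivExpr (ξ : VectField E M) (T : Tensor02 E M) (X Y : VectField E M) (x : M) : ℝ :=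
  mvfderiv 𝓘(ℝ, E) (T.eval X Y) x (ξ x)
    - T x (VectorField.mlieBracket 𝓘(ℝ, E) ξ X x) (Y x)
    - T x (X x) (VectorField.mlieBracket 𝓘(ℝ, E) ξ Y x)

variable {ξ : VectField E M} {T : Tensor02 E M} {x : M}

set_option linter.unusedSectionVars false in
theorem Tensor02.mdifferentiableAt_eval
    (hT : MDifferentiableAt 𝓘(ℝ, E) (𝓘(ℝ, E).prod 𝓘(ℝ, E →L[ℝ] E →L[ℝ] ℝ)) T.toTotal x)
    {X Y : VectField E M} (hX : MDiffAt (T% X) x) (hY : MDiffAt (T% Y) x) :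
    MDiffAt (T.eval X Y) x := by
  have h : MDifferentiableAt 𝓘(ℝ, E) (𝓘(ℝ, E).prod 𝓘(ℝ))
      (fun m ↦ TotalSpace.mk' ℝ (E := Bundle.Trivial M ℝ) m (T m (X m) (Y m))) x :=
    MDifferentiableAt.clm_bundle_apply₂ (F₁ := E) (F₂ := E) hT hX hY
  rw [mdifferentiableAt_section] at h
  exact h

theorem lieDerivExpr_tensorial_left
    (hT : MDifferentiableAt 𝓘(ℝ, E) (𝓘(ℝ, E).prod 𝓘(ℝ, E →L[ℝ] E →L[ℝ] ℝ)) T.toTotal x)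
    (Y : VectField E M) (hY : MDiffAt (T% Y) x) :
    TensorialAt 𝓘(ℝ, E) E (fun X ↦ lieDerivExpr ξ T X Y x) x where
  smul {f X} hf hX := by
    have : CompleteSpace E := FiniteDimensional.complete ℝ E
    have h1 : T.eval (f • X) Y = fun y ↦ f y * T.eval X Y y := by
      funext y; simp [Tensor02.eval]
    simp only [lieDerivExpr]
    rw [h1, mvfderiv_fun_mul hf (Tensor02.mdifferentiableAt_eval hT hX hY),
      VectorField.mlieBracket_smul_right hf hX]
    simp [Tensor02.eval]
    ring
  add {X X'} hX hX' := by
    have : CompleteSpace E := FiniteDimensional.complete ℝ E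
    have h1 : T.eval (X + X') Y = fun y ↦ T.eval X Y y + T.eval X' Y y := by
      funext y; simp [Tensor02.eval]
    simp only [lieDerivExpr]
    rw [h1, mvfderiv_fun_add (Tensor02.mdifferentiableAt_eval hT hX hY)
      (Tensor02.mdifferentiableAt_eval hT hX' hY), VectorField.mlieBracket_add_right hX hX']
    simp
    ring

theorem lieDerivExpr_tensorial_right
    (hT : MDifferentiableAt 𝓘(ℝ, E) (𝓘(ℝ, E).prod 𝓘(ℝ, E →L[ℝ] E →L[ℝ] ℝ)) T.toTotal x)
    (X : VectField E M) (hX : MDiffAt (T% X) x) :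
    TensorialAt 𝓘(ℝ, E) E (lieDerivExpr ξ T X · x) x where
  smul {f Y} hf hY := by
    have : CompleteSpace E := FiniteDimensional.complete ℝ E
    have h1 : T.eval X (f • Y) = fun y ↦ f y * T.eval X Y y := by
      funext y; simp [Tensor02.eval]
    simp only [lieDerivExpr]
    rw [h1, mvfderiv_fun_mul hf (Tensor02.mdifferentiableAt_eval hT hX hY),
      VectorField.mlieBracket_smul_right hf hY]
    simp [Tensor02.eval]
    ring
  add {Y Y'} hY hY' := by
    have : CompleteSpace E := FiniteDimensional.complete ℝ E
    have h1 : T.eval X (Y + Y') = fun y ↦ T.eval X Y y + T.eval X Y' y := by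
      funext y; simp [Tensor02.eval]
    simp only [lieDerivExpr]
    rw [h1, mvfderiv_fun_add (Tensor02.mdifferentiableAt_eval hT hX hY)
      (Tensor02.mdifferentiableAt_eval hT hX hY'), VectorField.mlieBracket_add_right hY hY']
    simp
    ring

open scoped Classical in
/-- The Lie derivative `𝓛_ξ T` of a `(0,2)`-tensor field `T`: the `(0,2)`-tensor field with
`(𝓛_ξ T)(X, Y) = ξ(T(X, Y)) - T([ξ, X], Y) - T(X, [ξ, Y])` for all vector fields `X`, `Y`
(see `lieDeriv_apply`). It has the value `0` at the points where `T` is not differentiable. -/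
def lieDeriv (ξ : VectField E M) (T : Tensor02 E M) : Tensor02 E M := fun x ↦
  if hT : MDifferentiableAt 𝓘(ℝ, E) (𝓘(ℝ, E).prod 𝓘(ℝ, E →L[ℝ] E →L[ℝ] ℝ)) T.toTotal x then
    TensorialAt.mkHom₂ (I := 𝓘(ℝ, E)) (F := E) (F' := E) (lieDerivExpr ξ T · · x) x
      (lieDerivExpr_tensorial_left hT) (lieDerivExpr_tensorial_right hT)
  else 0

theorem lieDeriv_apply
    (hT : MDifferentiableAt 𝓘(ℝ, E) (𝓘(ℝ, E).prod 𝓘(ℝ, E →L[ℝ] E →L[ℝ] ℝ)) T.toTotal x)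
    {X Y : VectField E M} (hX : MDiffAt (T% X) x) (hY : MDiffAt (T% Y) x) :
    lieDeriv ξ T x (X x) (Y x) =
      mvfderiv 𝓘(ℝ, E) (T.eval X Y) x (ξ x)
        - T x (VectorField.mlieBracket 𝓘(ℝ, E) ξ X x) (Y x)
        - T x (X x) (VectorField.mlieBracket 𝓘(ℝ, E) ξ Y x) := by
  simp only [lieDeriv, dif_pos hT]
  exact TensorialAt.mkHom₂_apply _ _ hX hY

end LieDerivative

/-! ### Semi-Riemannian metrics and the Levi-Civita connection -/

section Metrics

variable {E : Type*} [NormedAddCommGroup E] [NormedSpace ℝ E] [FiniteDimensional ℝ E]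
  {M : Type*} [TopologicalSpace M] [ChartedSpace E M] [IsManifold 𝓘(ℝ, E) ∞ M]

/-- The quadratic form `v ↦ T(v, v)` on the tangent space at `x`. -/
def Tensor02.quadForm (T : Tensor02 E M) (x : M) : QuadraticForm ℝ (TangentSpace 𝓘(ℝ, E) x) :=
  LinearMap.BilinMap.toQuadraticMap
    (LinearMap.mk₂ ℝ (fun v w ↦ T x v w) (by simp) (by simp) (by simp) (by simp))

/-- `g` is a semi-Riemannian metric of signature `(p, q)`: a smooth, symmetric, everywhere
non-degenerate `(0,2)`-tensor field with `p` positive and `q` negative directions at every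
point. -/
structure IsSemiRiemannianMetric (g : Tensor02 E M) (p q : ℕ) : Prop where
  smooth : g.IsSmooth
  symm : g.IsSymm
  nondegenerate : ∀ x v, (∀ w, g x v w = 0) → v = 0
  sigPos_eq : ∀ x, sigPos (g.quadForm x) = p
  sigNeg_eq : ∀ x, sigNeg (g.quadForm x) = q

/-- `cov` is the Levi-Civita connection of `g`: it is torsion-free and compatible with `g`.
(`cov Y x v` is `∇_v Y` at `x`.) -/
structure IsLeviCivita (g : Tensor02 E M)
    (cov : CovariantDerivative 𝓘(ℝ, E) E (TangentSpace 𝓘(ℝ, E) : M → Type _)) : Prop where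
  torsion_free : ∀ (X Y : VectField E M) (x : M), MDiffAt (T% X) x → MDiffAt (T% Y) x →
    cov Y x (X x) - cov X x (Y x) = VectorField.mlieBracket 𝓘(ℝ, E) X Y x
  compatible : ∀ (Y Z : VectField E M) (x : M) (v : TangentSpace 𝓘(ℝ, E) x),
    MDiffAt (T% Y) x → MDiffAt (T% Z) x →
    mvfderiv 𝓘(ℝ, E) (g.eval Y Z) x v = g x (cov Y x v) (Z x) + g x (Y x) (cov Z x v)

/-- The vector field `ξ` is geodesic for `g`: `∇_ξ ξ = 0` everywhere on `M`, where `∇` is the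
Levi-Civita connection of `g`. -/
def IsGeodesicField (g : Tensor02 E M) (ξ : VectField E M) : Prop :=
  ∃ cov : CovariantDerivative 𝓘(ℝ, E) E (TangentSpace 𝓘(ℝ, E) : M → Type _),
    IsLeviCivita g cov ∧ ∀ x, cov ξ x (ξ x) = 0

end Metrics

/-! ### Metric hypersurface data -/

section HypersurfaceData

/-- The bilinear form `𝒜((W, a), (V, b)) = γ(W, V) + a ℓ(V) + b ℓ(W) + a b ℓ2` on `F × ℝ`. -/
def hypersurfaceForm {F : Type*} [AddCommGroup F] [Module ℝ F] [TopologicalSpace F]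
    (γ : F →L[ℝ] F →L[ℝ] ℝ) (ℓ : F →L[ℝ] ℝ) (ℓ2 : ℝ) :
    LinearMap.BilinForm ℝ (F × ℝ) :=
  LinearMap.mk₂ ℝ (fun X Z ↦ γ X.1 Z.1 + X.2 * ℓ Z.1 + Z.2 * ℓ X.1 + X.2 * Z.2 * ℓ2)
    (by intros; simp; ring) (by intros; simp; ring) (by intros; simp; ring)
    (by intros; simp; ring)

variable (E : Type*) [NormedAddCommGroup E] [NormedSpace ℝ E] [FiniteDimensional ℝ E]
  (H : Type*) [TopologicalSpace H] [ChartedSpace E H] [IsManifold 𝓘(ℝ, E) ∞ H]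

/-- Metric hypersurface data on `H`: a symmetric `(0,2)`-tensor field `γ`, a one-form `ℓ` and a
function `ℓ2` (all smooth) such that `𝒜` is non-degenerate on `T_pH × ℝ` for every `p`. -/
structure MetricHypersurfaceData where
  γ : Tensor02 E H
  ℓ : OneForm E H
  ℓ2 : H → ℝ
  γ_smooth : γ.IsSmooth
  γ_symm : γ.IsSymm
  ℓ_smooth : ℓ.IsSmooth
  ℓ2_smooth : ContMDiff 𝓘(ℝ, E) 𝓘(ℝ) ∞ ℓ2
  nondegenerate : ∀ p, (hypersurfaceForm (γ p) (ℓ p) (ℓ2 p)).Nondegenerate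

variable {E H}

namespace MetricHypersurfaceData

instance (p : H) : FiniteDimensional ℝ (TangentSpace 𝓘(ℝ, E) p × ℝ) :=
  inferInstanceAs (FiniteDimensional ℝ (E × ℝ))

/-- The vector `(n, n2)` of `T_pH × ℝ` with `𝒜((n, n2), (V, b)) = b` for all `(V, b)`, that is,
the contraction of the inverse `𝒜♯` with the covector `(0, 1)`. -/
def sharpOne (D : MetricHypersurfaceData E H) (p : H) : TangentSpace 𝓘(ℝ, E) p × ℝ :=
  ((hypersurfaceForm (D.γ p) (D.ℓ p) (D.ℓ2 p)).toDual (D.nondegenerate p)).symm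
    (LinearMap.snd ℝ (TangentSpace 𝓘(ℝ, E) p) ℝ)

/-- The scalar `n2 = 𝒜♯((0, 1), (0, 1))`. -/
def n2 (D : MetricHypersurfaceData E H) (p : H) : ℝ := (D.sharpOne p).2

/-- The data is null if `n2` vanishes identically. -/
def IsNull (D : MetricHypersurfaceData E H) : Prop := ∀ p, D.n2 p = 0

end MetricHypersurfaceData

variable {E' : Type*} [NormedAddCommGroup E'] [NormedSpace ℝ E'] [FiniteDimensional ℝ E']
  {M : Type*} [TopologicalSpace M] [ChartedSpace E' M] [IsManifold 𝓘(ℝ, E') ∞ M]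

/-- The pullback `Φ^* T` of a `(0,2)`-tensor field, evaluated at `v`, `w` in `T_pH`. -/
def pullback02 (Φ : H → M) (T : Tensor02 E' M) (p : H) (v w : TangentSpace 𝓘(ℝ, E) p) : ℝ :=
  T (Φ p) (mfderiv 𝓘(ℝ, E) 𝓘(ℝ, E') Φ p v) (mfderiv 𝓘(ℝ, E) 𝓘(ℝ, E') Φ p w)

/-- The metric hypersurface data `D` is `(Φ, ξ)`-embedded in `(M, g)`, where the rigging is the
restriction to `Φ(H)` of the vector field `ξ` on `M`. -/
structure MetricHypersurfaceData.IsEmbeddedIn (D : MetricHypersurfaceData E H)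
    (g : Tensor02 E' M) (Φ : H → M) (ξ : VectField E' M) : Prop where
  embedding : Manifold.IsSmoothEmbedding 𝓘(ℝ, E) 𝓘(ℝ, E') ∞ Φ
  rigging_smooth : ξ.IsSmooth
  transversal : ∀ p, ξ (Φ p) ∉ Set.range (mfderiv 𝓘(ℝ, E) 𝓘(ℝ, E') Φ p)
  pullback_metric : ∀ p v w, pullback02 Φ g p v w = D.γ p v w
  pullback_one_form : ∀ p v, g (Φ p) (ξ (Φ p)) (mfderiv 𝓘(ℝ, E) 𝓘(ℝ, E') Φ p v) = D.ℓ p v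
  pullback_function : ∀ p, g (Φ p) (ξ (Φ p)) (ξ (Φ p)) = D.ℓ2 p

end HypersurfaceData

end

/-!
The ambient manifold is a neighbourhood of `{0} × H` in the cylinder `ℝ × H`, with `Φ` the zero
section and `ξ = ∂_r`. Tensor fields on it are families, parametrized by `r`, of bilinear forms on
`ℝ × T_pH`, and `𝓛_ξ` is the derivative of such a family with respect to `r`
(`lieDeriv_familyTensor`). The metric is

  `g((a, v), (b, w)) = ℓ2 a b + a η_r(w) + b η_r(v) + S_r(v, w)`,  `η_r = ℓ + (r / 2) dℓ2`.

For `r = 0` and `S_0 = γ` this is the form `𝒜` of the hypersurface data, so it is non-degenerate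
there, hence near `{0} × H`; its signature is locally constant
(`SmoothFamily.isSemiRiemannianMetric`), and both of its entries are positive because the null
vector `n` of the data is isotropic and non-zero.

The Levi-Civita connection is constructed from the Koszul formula (`exists_isLeviCivita`). That it
is compatible with the metric and torsion-free gives
`g(∇_ξ ξ, w) = (𝓛_ξ g)(ξ, w) - ½ d(g(ξ, ξ))(w)` (`isGeodesicField_of_lieDeriv`). Here
`g(ξ, ξ) = ℓ2` does not depend on `r`, and `(𝓛_ξ g)(ξ, ·) = ½ dℓ2` by the choice of `η_r`, so `ξ`
is geodesic on the whole manifold, whatever the family `S` is.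

It remains to find a smooth family `S_r` of symmetric tensor fields on `H` whose derivatives at
`r = 0` are `γ, 2 Y_1, 2 Y_2, …`. This is Borel's lemma: `S_r = ∑ c_k(r) Z_k` with cut-off monomials
`c_k(r) = r^k / k! · χ(r / ε_k)`. The scales `ε_k` have to be the same at all points of `H`. This is
achieved by a diagonal choice for the components of the `Z_k` in countably many charts, cut off to
have compact support (`exists_borel_coefficients`, `exists_family_iteratedDeriv_eq`); no partition
of unity is needed, as the coefficients `c_k` are scalar.
-/

open Filter Topology

/-! ### Borel's lemma with parameters -/

/-- Rescaled cut-off monomials, the coefficient functions in Borel's lemma: near `0` the function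
is `r ^ k / k!`, while all its derivatives of order less than `k` are as small as required. -/
theorem exists_cutoff_monomial (k : ℕ) {ε : ℝ} (hε : 0 < ε) :
    ∃ c : ℝ → ℝ, ContDiff ℝ ∞ c ∧ (c =ᶠ[𝓝 0] fun r ↦ r ^ k / (k.factorial : ℝ)) ∧
      ∀ i < k, ∀ r, ‖iteratedFDeriv ℝ i c r‖ ≤ ε := by
  let χ : ContDiffBump (0 : ℝ) := ⟨1, 2, one_pos, one_lt_two⟩
  let φ : ℝ → ℝ := fun s ↦ s ^ k / (k.factorial : ℝ) * χ s
  have hφ : ContDiff ℝ ∞ φ := by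
    exact ((contDiff_id.pow k).div_const _).mul χ.contDiff
  have hφc : HasCompactSupport φ := χ.hasCompactSupport.mul_left
  have hbd : ∀ i, ∃ K, ∀ s, ‖iteratedFDeriv ℝ i φ s‖ ≤ K := fun i ↦
    (hφ.continuous_iteratedFDeriv (m := i)
      (by exact_mod_cast le_top)).bounded_above_of_compact_support (hφc.iteratedFDeriv i)
  choose K hK using hbd
  have hK0 : ∀ i, 0 ≤ K i := fun i ↦ (norm_nonneg _).trans (hK i 0)
  let L : ℝ := ∑ i ∈ Finset.range k, K i
  have hL0 : 0 ≤ L := Finset.sum_nonneg fun i _ ↦ hK0 i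
  let t : ℝ := 1 + L / ε
  have ht1 : 1 ≤ t := by have : 0 ≤ L / ε := by positivity
                         simp only [t]; linarith
  have ht0 : 0 < t := by linarith
  have htL : L ≤ ε * t := by
    have : ε * t = ε + L := by simp only [t]; field_simp
    linarith
  refine ⟨fun r ↦ (t ^ k)⁻¹ * φ (t * r), ?_, ?_, ?_⟩
  · fun_prop
  · have h1 : ∀ᶠ r in 𝓝 (0 : ℝ), χ (t * r) = 1 := by
      have h2 : Tendsto (fun r : ℝ ↦ t * r) (𝓝 0) (𝓝 0) := by
        have : Continuous fun r : ℝ ↦ t * r := by fun_prop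
        simpa using this.tendsto 0
      filter_upwards [h2.eventually (χ.eventuallyEq_one)] with r hr using by simpa using hr
    filter_upwards [h1] with r hr
    simp only [φ, hr, mul_pow]
    field_simp
  · intro i hi r
    have hφi : ContDiff ℝ i φ := hφ.of_le (by exact_mod_cast le_top)
    rw [norm_iteratedFDeriv_eq_norm_iteratedDeriv, iteratedDeriv_const_mul_field,
      iteratedDeriv_comp_const_mul hφi, norm_mul, norm_mul,
      Real.norm_of_nonneg (by positivity), Real.norm_of_nonneg (by positivity)]
    have h3 : ‖iteratedDeriv i φ (t * r)‖ ≤ L := by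
      rw [← norm_iteratedFDeriv_eq_norm_iteratedDeriv]
      exact (hK i _).trans
        (Finset.single_le_sum (f := K) (fun j _ ↦ hK0 j) (Finset.mem_range.2 hi))
    have h4 : t ^ i * t ≤ t ^ k := by
      rw [← pow_succ]; exact pow_le_pow_right₀ ht1 hi
    calc (t ^ k)⁻¹ * (t ^ i * ‖iteratedDeriv i φ (t * r)‖)
        ≤ (t ^ k)⁻¹ * (t ^ i * (ε * t)) := by gcongr; exact h3.trans htL
      _ = (t ^ k)⁻¹ * (t ^ i * t) * ε := by ring
      _ ≤ (t ^ k)⁻¹ * t ^ k * ε := by gcongr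
      _ = ε := by field_simp

section Series

variable {E : Type*} [NormedAddCommGroup E] [NormedSpace ℝ E]
  {W : Type*} [NormedAddCommGroup W] [NormedSpace ℝ W]

theorem norm_iteratedFDeriv_smul_prod_le {c : ℝ → ℝ} {F : E → W} {ε C : ℝ} {m : ℕ}
    (hc : ContDiff ℝ ∞ c) (hF : ContDiff ℝ ∞ F) (hε : 0 ≤ ε)
    (hcε : ∀ i ≤ m, ∀ r, ‖iteratedFDeriv ℝ i c r‖ ≤ ε)
    (hFC : ∀ i ≤ m, ∀ z, ‖iteratedFDeriv ℝ i F z‖ ≤ C) (z : ℝ × E) :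
    ‖iteratedFDeriv ℝ m (fun z : ℝ × E ↦ c z.1 • F z.2) z‖ ≤ 2 ^ m * (ε * C) := by
  have h1 : ∀ i ≤ m, ‖iteratedFDeriv ℝ i (fun z : ℝ × E ↦ c z.1) z‖ ≤ ε := by
    intro i hi
    have := (ContinuousLinearMap.fst ℝ ℝ E).iteratedFDeriv_comp_right hc z (i := i)
      (by exact_mod_cast le_top)
    change iteratedFDeriv ℝ i (fun z : ℝ × E ↦ c z.1) z = _ at this
    rw [this]
    refine (ContinuousMultilinearMap.norm_compContinuousLinearMap_le _ _).trans ?_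
    refine (mul_le_of_le_one_right (norm_nonneg _) ?_).trans (hcε i hi _)
    exact Finset.prod_le_one (fun _ _ ↦ norm_nonneg _)
      fun _ _ ↦ ContinuousLinearMap.norm_fst_le ℝ ℝ E
  have h2 : ∀ i ≤ m, ‖iteratedFDeriv ℝ i (fun z : ℝ × E ↦ F z.2) z‖ ≤ C := by
    intro i hi
    have := (ContinuousLinearMap.snd ℝ ℝ E).iteratedFDeriv_comp_right hF z (i := i)
      (by exact_mod_cast le_top)
    change iteratedFDeriv ℝ i (fun z : ℝ × E ↦ F z.2) z = _ at this
    rw [this]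
    refine (ContinuousMultilinearMap.norm_compContinuousLinearMap_le _ _).trans ?_
    refine (mul_le_of_le_one_right (norm_nonneg _) ?_).trans (hFC i hi _)
    exact Finset.prod_le_one (fun _ _ ↦ norm_nonneg _)
      fun _ _ ↦ ContinuousLinearMap.norm_snd_le ℝ ℝ E
  refine (norm_iteratedFDeriv_smul_le (N := ∞) (hc.comp contDiff_fst) (hF.comp contDiff_snd) z
    (by exact_mod_cast le_top)).trans ?_
  calc _ ≤ ∑ i ∈ Finset.range (m + 1), (m.choose i : ℝ) * (ε * C) := by
        refine Finset.sum_le_sum fun i hi ↦ ?_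
        have hi' : i ≤ m := Nat.lt_succ_iff.1 (Finset.mem_range.1 hi)
        rw [mul_assoc]
        gcongr
        · exact h1 i hi'
        · exact h2 _ (Nat.sub_le _ _)
    _ = 2 ^ m * (ε * C) := by
        rw [← Finset.sum_mul]
        congr 1
        exact_mod_cast Nat.sum_range_choose m

/-- A series `∑ c_k(r) F_k(z)` whose coefficients are small compared with the derivatives of the
`F_k` is smooth. -/
theorem contDiff_tsum_smul_of_small [CompleteSpace W] {c : ℕ → ℝ → ℝ} {F : ℕ → E → W} {ε C : ℕ → ℝ}
    (hc : ∀ k, ContDiff ℝ ∞ (c k)) (hε : ∀ k, 0 ≤ ε k)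
    (hcε : ∀ k, ∀ i < k, ∀ r, ‖iteratedFDeriv ℝ i (c k) r‖ ≤ ε k)
    (hF : ∀ k, ContDiff ℝ ∞ (F k))
    (hFC : ∀ᶠ k in atTop, ∀ i < k, ∀ z, ‖iteratedFDeriv ℝ i (F k) z‖ ≤ C k)
    (hεC : ∀ k, ε k * C k ≤ (1 / 4) ^ k) :
    ContDiff ℝ ∞ fun z : ℝ × E ↦ ∑' k, c k z.1 • F k z.2 := by
  refine contDiff_tsum_of_eventually (v := fun _ k ↦ (1 / 2 : ℝ) ^ k)
    (fun k ↦ ((hc k).comp contDiff_fst).smul ((hF k).comp contDiff_snd))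
    (fun _ _ ↦ summable_geometric_of_lt_one (by norm_num) (by norm_num)) fun m _ ↦ ?_
  rw [Nat.cofinite_eq_atTop]
  filter_upwards [hFC, eventually_gt_atTop m] with k hk hmk z
  calc _ ≤ 2 ^ m * (ε k * C k) := norm_iteratedFDeriv_smul_prod_le (hc k) (hF k) (hε k)
        (fun i hi ↦ hcε k i (hi.trans_lt hmk)) (fun i hi ↦ hk i (hi.trans_lt hmk)) z
    _ ≤ 2 ^ k * (1 / 4) ^ k := by
        exact mul_le_mul (pow_le_pow_right₀ one_le_two hmk.le) (hεC k)
          (mul_nonneg (hε k) ((norm_nonneg _).trans (hk m hmk z.2))) (by positivity)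
    _ = (1 / 2) ^ k := by rw [← mul_pow]; norm_num

/-- The Taylor coefficients at `0` of `∑ c_k(r) w_k` are the `w_k`. The terms of index larger than
`n` are differentiated `n` times term by term, and vanish to higher order at `0`. -/
theorem iteratedDeriv_tsum_cutoff_monomial {c : ℕ → ℝ → ℝ} {w : ℕ → ℝ} {u : ℕ → ℝ}
    (hc : ∀ k, ContDiff ℝ ∞ (c k))
    (hc0 : ∀ k, c k =ᶠ[𝓝 0] fun r ↦ r ^ k / (k.factorial : ℝ))
    (hu : Summable u) (hcu : ∀ k, ∀ i < k, ∀ r, ‖iteratedFDeriv ℝ i (c k) r‖ * |w k| ≤ u k) :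
    (∀ r, Summable fun k ↦ c k r * w k) ∧
      ∀ n, iteratedDeriv n (fun r ↦ ∑' k, c k r * w k) 0 = w n := by
  have hs : ∀ r, Summable fun k ↦ c k r * w k := by
    intro r
    refine Summable.of_norm_bounded_eventually hu ?_
    rw [Nat.cofinite_eq_atTop]
    filter_upwards [eventually_gt_atTop 0] with k hk
    simpa [norm_mul] using hcu k 0 hk r
  refine ⟨hs, fun n ↦ ?_⟩
  -- derivatives of a single term
  have hd : ∀ k m, iteratedDeriv m (fun r ↦ c k r * w k) 0 = if m = k then w k else 0 := by
    intro k m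
    have h1 : (fun r ↦ c k r * w k) =ᶠ[𝓝 0] fun r ↦ (w k / (k.factorial : ℝ)) * r ^ k := by
      filter_upwards [hc0 k] with r hr
      rw [hr]; ring
    rw [h1.iteratedDeriv_eq m, iteratedDeriv_const_mul_field, iteratedDeriv_fun_pow_zero]
    split_ifs with h
    · subst h
      field_simp
    · simp
  have hsm : ∀ k, ContDiff ℝ n (fun r ↦ c k r * w k) := fun k ↦
    ((hc k).mul contDiff_const).of_le (by exact_mod_cast le_top)
  have hsplit : (fun r ↦ ∑' k, c k r * w k) = fun r ↦ (∑ k ∈ Finset.range (n + 1), c k r * w k) +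
      ∑' k, c (k + (n + 1)) r * w (k + (n + 1)) := by
    funext r
    exact ((hs r).sum_add_tsum_nat_add (n + 1)).symm
  have hb : ∀ (m k : ℕ) (r : ℝ), (m : ℕ∞) ≤ n →
      ‖iteratedFDeriv ℝ m (fun r ↦ c (k + (n + 1)) r * w (k + (n + 1))) r‖ ≤ u (k + (n + 1)) := by
    intro m k r hm
    have hm' : m ≤ n := by exact_mod_cast hm
    refine le_trans (le_of_eq ?_) (hcu (k + (n + 1)) m (by omega) r)
    rw [norm_iteratedFDeriv_eq_norm_iteratedDeriv, norm_iteratedFDeriv_eq_norm_iteratedDeriv]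
    have h2 : (fun r ↦ c (k + (n + 1)) r * w (k + (n + 1))) =
        fun r ↦ w (k + (n + 1)) * c (k + (n + 1)) r := by funext r; ring
    rw [h2, iteratedDeriv_const_mul_field, norm_mul, mul_comm, Real.norm_eq_abs (w _)]
  have hu' : ∀ m : ℕ, (m : ℕ∞) ≤ n → Summable fun k ↦ u (k + (n + 1)) := fun _ _ ↦
    (summable_nat_add_iff (n + 1)).2 hu
  have htail : ContDiff ℝ n fun r ↦ ∑' k, c (k + (n + 1)) r * w (k + (n + 1)) :=
    contDiff_tsum (N := n) (fun k ↦ hsm _) hu' hb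
  have htail0 : iteratedDeriv n (fun r ↦ ∑' k, c (k + (n + 1)) r * w (k + (n + 1))) 0 = 0 := by
    rw [iteratedDeriv_eq_iteratedFDeriv,
      iteratedFDeriv_tsum_apply (N := n) (fun k ↦ hsm _) hu' hb le_rfl]
    have : ∀ k, iteratedFDeriv ℝ n (fun r ↦ c (k + (n + 1)) r * w (k + (n + 1))) 0 = 0 := by
      intro k
      rw [← norm_eq_zero, norm_iteratedFDeriv_eq_norm_iteratedDeriv, hd, if_neg (by omega),
        norm_zero]
    simp [this]
  rw [hsplit, iteratedDeriv_fun_add (ContDiff.contDiffAt (ContDiff.sum fun k _ ↦ hsm k))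
    htail.contDiffAt, htail0, add_zero, iteratedDeriv_fun_sum fun k _ ↦ (hsm k).contDiffAt]
  simp [hd]

/-- **Borel's lemma with parameters.** For countably many sequences of smooth compactly supported
functions there are coefficient functions `c_k`, common to all the sequences, for which all the
series `∑ c_k(r) F_{j,k}(z)` are smooth, and with which every sequence of numbers dominated by some
`(‖F_{j,k}(z)‖)_k` is the sequence of derivatives at `0` of the corresponding series. -/
theorem exists_borel_coefficients [CompleteSpace W] (F : ℕ → ℕ → E → W)
    (hF : ∀ j k, ContDiff ℝ ∞ (F j k)) (hFc : ∀ j k, HasCompactSupport (F j k)) :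
    ∃ c : ℕ → ℝ → ℝ,
      (∀ j, ContDiff ℝ ∞ fun z : ℝ × E ↦ ∑' k, c k z.1 • F j k z.2) ∧
      ∀ (w : ℕ → ℝ) (j : ℕ) (z : E) (A : ℝ), (∀ k, |w k| ≤ A * ‖F j k z‖) →
        (∀ r, Summable fun k ↦ c k r * w k) ∧
          ∀ n, iteratedDeriv n (fun r ↦ ∑' k, c k r * w k) 0 = w n := by
  have hbd : ∀ j k i, ∃ K, ∀ z, ‖iteratedFDeriv ℝ i (F j k) z‖ ≤ K := fun j k i ↦
    ((hF j k).continuous_iteratedFDeriv (m := i)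
      (by exact_mod_cast le_top)).bounded_above_of_compact_support ((hFc j k).iteratedFDeriv i)
  choose K hK using hbd
  have hK0 : ∀ j k i, 0 ≤ K j k i := fun j k i ↦ (norm_nonneg _).trans (hK j k i 0)
  -- the diagonal choice: `C k` controls the derivatives of order `≤ k` of the first `k` sequences
  let C : ℕ → ℝ := fun k ↦
    1 + ∑ j ∈ Finset.range (k + 1), ∑ i ∈ Finset.range (k + 1), K j k i
  have hC1 : ∀ k, 1 ≤ C k := fun k ↦ le_add_of_nonneg_right
    (Finset.sum_nonneg fun j _ ↦ Finset.sum_nonneg fun i _ ↦ hK0 j k i)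
  have hKC : ∀ j k i, j ≤ k → i ≤ k → K j k i ≤ C k := by
    intro j k i hj hi
    have h1 : K j k i ≤ ∑ i ∈ Finset.range (k + 1), K j k i :=
      Finset.single_le_sum (f := fun i ↦ K j k i) (fun i _ ↦ hK0 j k i)
        (Finset.mem_range.2 (by omega))
    have h2 : ∑ i ∈ Finset.range (k + 1), K j k i ≤
        ∑ j ∈ Finset.range (k + 1), ∑ i ∈ Finset.range (k + 1), K j k i :=
      Finset.single_le_sum (f := fun j ↦ ∑ i ∈ Finset.range (k + 1), K j k i)
        (fun j _ ↦ Finset.sum_nonneg fun i _ ↦ hK0 j k i) (Finset.mem_range.2 (by omega))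
    simp only [C]
    linarith
  have hC0 : ∀ k, 0 < C k := fun k ↦ one_pos.trans_le (hC1 k)
  let ε : ℕ → ℝ := fun k ↦ (1 / 4) ^ k / C k
  have hε : ∀ k, 0 < ε k := fun k ↦ div_pos (by positivity) (hC0 k)
  have hεC : ∀ k, ε k * C k = (1 / 4) ^ k := fun k ↦ div_mul_cancel₀ _ (hC0 k).ne'
  choose c hc hc0 hcε using fun k ↦ exists_cutoff_monomial k (hε k)
  refine ⟨c, fun j ↦ ?_, fun w j z A hw ↦ ?_⟩
  · refine contDiff_tsum_smul_of_small hc (fun k ↦ (hε k).le) hcε (hF j) ?_ fun k ↦ (hεC k).le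
    filter_upwards [eventually_ge_atTop j] with k hk i hi z
    exact (hK j k i z).trans (hKC j k i hk hi.le)
  · -- for the finitely many `k < j` the bound is `ε k * |w k|` itself
    refine iteratedDeriv_tsum_cutoff_monomial hc hc0 (u := fun k ↦ ε k * |w k|) ?_ fun k i hi r ↦ ?_
    · have hg : Summable fun k : ℕ ↦ |A| * (1 / 4 : ℝ) ^ k :=
        (summable_geometric_of_lt_one (by norm_num) (by norm_num)).mul_left _
      refine Summable.of_norm_bounded_eventually hg ?_
      rw [Nat.cofinite_eq_atTop]
      filter_upwards [eventually_ge_atTop j] with k hk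
      have h1 : ‖F j k z‖ ≤ C k := by
        have := hK j k 0 z
        rw [norm_iteratedFDeriv_zero] at this
        exact this.trans (hKC j k 0 hk (Nat.zero_le _))
      rw [Real.norm_of_nonneg (mul_nonneg (hε k).le (abs_nonneg _))]
      calc ε k * |w k| ≤ ε k * (|A| * C k) := by
            refine mul_le_mul_of_nonneg_left ?_ (hε k).le
            exact (hw k).trans (mul_le_mul (le_abs_self A) h1 (norm_nonneg _) (abs_nonneg _))
        _ = |A| * (1 / 4) ^ k := by rw [← hεC k]; ring
    · exact mul_le_mul_of_nonneg_right (hcε k i hi r) (abs_nonneg _)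

end Series

/-! ### Non-degenerate forms and their signature -/

section Forms

variable {V : Type*} [NormedAddCommGroup V] [NormedSpace ℝ V]

/-- A shortcut: instance search for this iterated space of linear maps is slow. -/
noncomputable instance bilinForm.instNormedAddCommGroup : NormedAddCommGroup (V →L[ℝ] V →L[ℝ] ℝ) :=
  ContinuousLinearMap.toNormedAddCommGroup

/-- A shortcut: instance search for this iterated space of linear maps is slow. -/
noncomputable instance bilinForm.instNormedSpace : NormedSpace ℝ (V →L[ℝ] V →L[ℝ] ℝ) :=
  ContinuousLinearMap.toNormedSpace

/-- The quadratic form `v ↦ b(v, v)` of a continuous bilinear form `b`. -/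
noncomputable def bilinQuadForm {V : Type*} [AddCommGroup V] [Module ℝ V] [TopologicalSpace V]
    (b : V →L[ℝ] V →L[ℝ] ℝ) : QuadraticForm ℝ V :=
  LinearMap.BilinMap.toQuadraticMap
    (LinearMap.mk₂ ℝ (fun v w ↦ b v w) (by simp) (by simp) (by simp) (by simp))

@[simp] theorem bilinQuadForm_apply {V : Type*} [AddCommGroup V] [Module ℝ V] [TopologicalSpace V]
    (b : V →L[ℝ] V →L[ℝ] ℝ) (v : V) :
    bilinQuadForm b v = b v v := rfl

/-- A maximal subspace on which `b` is positive definite keeps this property for all nearby forms,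
by compactness of its unit sphere. -/
theorem eventually_sigPos_le [FiniteDimensional ℝ V] (b : V →L[ℝ] V →L[ℝ] ℝ) :
    ∀ᶠ b' in 𝓝 b, sigPos (bilinQuadForm b) ≤ sigPos (bilinQuadForm b') := by
  obtain ⟨P, hP, hpos⟩ := exists_finrank_eq_sigPos_and_posDef (bilinQuadForm b)
  have hK : IsCompact (Metric.sphere (0 : P) 1) := isCompact_sphere 0 1
  have hev : ∀ᶠ b' in 𝓝 b, ∀ v ∈ Metric.sphere (0 : P) 1, 0 < b' v v := by
    refine hK.eventually_forall_of_forall_eventually fun v hv ↦ ?_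
    have hv0 : v ≠ 0 := by
      rintro rfl
      simp at hv
    have hc : Continuous fun x : (V →L[ℝ] V →L[ℝ] ℝ) × P ↦ x.1 (x.2 : V) (x.2 : V) := by fun_prop
    have h0 : 0 < b v v := hpos v hv0
    exact (hc.tendsto (b, v)).eventually (lt_mem_nhds h0)
  filter_upwards [hev] with b' hb'
  rw [← hP]
  refine le_sigPos_of_posDef _ fun v hv ↦ ?_
  have hn : 0 < ‖v‖ := norm_pos_iff.2 hv
  have h1 := hb' (‖v‖⁻¹ • v) (by
    rw [mem_sphere_zero_iff_norm, norm_smul, norm_inv, norm_norm, inv_mul_cancel₀ hn.ne'])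
  have h2 : 0 < ‖v‖⁻¹ * (‖v‖⁻¹ * b' v v) := by simpa using h1
  have h3 : 0 < b' v v := by
    by_contra h
    push Not at h
    have : ‖v‖⁻¹ * (‖v‖⁻¹ * b' v v) ≤ 0 :=
      mul_nonpos_of_nonneg_of_nonpos (by positivity)
        (mul_nonpos_of_nonneg_of_nonpos (by positivity) h)
    linarith
  exact h3

theorem sigNeg_bilinQuadForm (b : V →L[ℝ] V →L[ℝ] ℝ) :
    sigNeg (bilinQuadForm b) = sigPos (bilinQuadForm ((-1 : ℝ) • b)) := by
  rw [← sigPos_neg]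
  congr 1
  ext v
  simp

theorem sigPos_add_sigNeg_of_nondegenerate [FiniteDimensional ℝ V] {b : V →L[ℝ] V →L[ℝ] ℝ}
    (hs : ∀ v w, b v w = b w v)
    (hb : ∀ v, (∀ w, b v w = 0) → v = 0) :
    sigPos (bilinQuadForm b) + sigNeg (bilinQuadForm b) = Module.finrank ℝ V := by
  have h := QuadraticForm.sigPos_add_sigNeg_add_radical (Q := bilinQuadForm b)
  have hr : (bilinQuadForm b).radical = ⊥ := by
    rw [eq_bot_iff]
    intro v hv
    have h2 : QuadraticMap.polar (bilinQuadForm b) v = 0 := by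
      ext w
      have := LinearMap.congr_fun (QuadraticMap.radical_le_ker_polarBilin hv) w
      simpa using this
    rw [Submodule.mem_bot]
    refine hb v fun w ↦ ?_
    have h3 := congr_fun h2 w
    simp only [QuadraticMap.polar, bilinQuadForm_apply, map_add, add_apply,
      hs w v, Pi.zero_apply] at h3
    linarith
  rw [hr] at h
  simpa using h

/-- The signature of a non-degenerate symmetric form is locally constant. -/
theorem eventually_sig_eq [FiniteDimensional ℝ V] {b : V →L[ℝ] V →L[ℝ] ℝ}
    (hs : ∀ v w, b v w = b w v)
    (hb : ∀ v, (∀ w, b v w = 0) → v = 0) :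
    ∀ᶠ b' in 𝓝 b, (∀ v w, b' v w = b' w v) → (∀ v, (∀ w, b' v w = 0) → v = 0) →
      sigPos (bilinQuadForm b') = sigPos (bilinQuadForm b) ∧
      sigNeg (bilinQuadForm b') = sigNeg (bilinQuadForm b) := by
  have h2 : ∀ᶠ b' in 𝓝 b, sigNeg (bilinQuadForm b) ≤ sigNeg (bilinQuadForm b') := by
    simp only [sigNeg_bilinQuadForm]
    have hc : Continuous fun b' : V →L[ℝ] V →L[ℝ] ℝ ↦ (-1 : ℝ) • b' := continuous_const_smul _
    exact (hc.tendsto b).eventually (eventually_sigPos_le ((-1 : ℝ) • b))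
  filter_upwards [eventually_sigPos_le b, h2] with b' h1 h2 hs' hb'
  have h3 := sigPos_add_sigNeg_of_nondegenerate hs hb
  have h4 := sigPos_add_sigNeg_of_nondegenerate hs' hb'
  omega

theorem isOpen_setOf_nondegenerate [FiniteDimensional ℝ V] :
    IsOpen {b : V →L[ℝ] V →L[ℝ] ℝ | ∀ v, (∀ w, b v w = 0) → v = 0} := by
  convert! ContinuousLinearMap.isOpen_injective (𝕜 := ℝ) (E := V) (F := V →L[ℝ] ℝ) using 1
  ext b
  simp only [Set.mem_ofPred_eq]
  rw [injective_iff_map_eq_zero]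
  refine forall_congr' fun v ↦ ?_
  rw [ContinuousLinearMap.ext_iff]
  rfl

/-- A non-degenerate symmetric form with a non-zero isotropic vector is indefinite. -/
theorem sig_pos_of_isotropic [FiniteDimensional ℝ V] {b : V →L[ℝ] V →L[ℝ] ℝ}
    (hs : ∀ v w, b v w = b w v)
    (hb : ∀ v, (∀ w, b v w = 0) → v = 0) {n : V} (hn : n ≠ 0) (hnn : b n n = 0) :
    0 < sigPos (bilinQuadForm b) ∧ 0 < sigNeg (bilinQuadForm b) := by
  have h3 := sigPos_add_sigNeg_of_nondegenerate hs hb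
  have key : ∀ Q : QuadraticForm ℝ V, Q n = 0 → sigPos Q ≠ Module.finrank ℝ V := by
    intro Q hQ h
    obtain ⟨P, hP, hpos⟩ := exists_finrank_eq_sigPos_and_posDef Q
    have hPt : P = ⊤ := Submodule.eq_top_of_finrank_eq (hP.trans h)
    have := hpos ⟨n, hPt ▸ Submodule.mem_top⟩ (by simpa using hn)
    simp [hQ] at this
  have k1 := key (bilinQuadForm b) (by simpa using hnn)
  have k2 := key (-bilinQuadForm b) (by simpa using hnn)
  rw [sigPos_neg] at k2
  omega

/-- The signature does not change under a linear change of coordinates. -/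
theorem sig_bilinearComp {V' : Type*} [NormedAddCommGroup V'] [NormedSpace ℝ V']
    (b : V' →L[ℝ] V' →L[ℝ] ℝ) (e : V ≃L[ℝ] V') :
    sigPos (bilinQuadForm (b.bilinearComp (e : V →L[ℝ] V') (e : V →L[ℝ] V'))) =
      sigPos (bilinQuadForm b) ∧
    sigNeg (bilinQuadForm (b.bilinearComp (e : V →L[ℝ] V') (e : V →L[ℝ] V'))) =
      sigNeg (bilinQuadForm b) := by
  have h : QuadraticMap.Equivalent
      (bilinQuadForm (b.bilinearComp (e : V →L[ℝ] V') (e : V →L[ℝ] V'))) (bilinQuadForm b) :=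
    ⟨⟨e.toLinearEquiv, fun v ↦ by simp⟩⟩
  exact ⟨h.sigPos_eq, h.sigNeg_eq⟩

end Forms

/-! ### Coordinate frames, the Levi-Civita connection and geodesic fields -/

section TensorFields

variable {E : Type*} [NormedAddCommGroup E] [NormedSpace ℝ E]
  {M : Type*} [TopologicalSpace M] [ChartedSpace E M]

theorem Tensor02.eval_smul_left (g : Tensor02 E M) (f : M → ℝ) (X Y : VectField E M) :
    g.eval (f • X) Y = fun y ↦ f y * g.eval X Y y := by
  funext y; simp [Tensor02.eval]

theorem Tensor02.eval_smul_right (g : Tensor02 E M) (f : M → ℝ) (X Y : VectField E M) :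
    g.eval X (f • Y) = fun y ↦ f y * g.eval X Y y := by
  funext y; simp [Tensor02.eval]

theorem Tensor02.eval_add_left (g : Tensor02 E M) (X X' Y : VectField E M) :
    g.eval (X + X') Y = fun y ↦ g.eval X Y y + g.eval X' Y y := by
  funext y; simp [Tensor02.eval]

theorem Tensor02.eval_add_right (g : Tensor02 E M) (X Y Y' : VectField E M) :
    g.eval X (Y + Y') = fun y ↦ g.eval X Y y + g.eval X Y' y := by
  funext y; simp [Tensor02.eval]

theorem Tensor02.IsSmooth.mdifferentiableAt [IsManifold 𝓘(ℝ, E) ∞ M]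
    {g : Tensor02 E M} (hg : g.IsSmooth) (x : M) :
    MDifferentiableAt 𝓘(ℝ, E) (𝓘(ℝ, E).prod 𝓘(ℝ, E →L[ℝ] E →L[ℝ] ℝ)) g.toTotal x :=
  (hg x).mdifferentiableAt (by simp)

end TensorFields

section CoordinateFrame

variable {E : Type*} [NormedAddCommGroup E] [NormedSpace ℝ E]
  {M : Type*} [TopologicalSpace M] [ChartedSpace E M] [IsManifold 𝓘(ℝ, E) ∞ M]

/-- The coordinate frame of the chart at `x₀`, as a linear map `E → T_xM`. Its values are read in
`E`, the model space of all tangent spaces. -/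
noncomputable def coordFrame (x₀ x : M) : E →L[ℝ] E :=
  (trivializationAt E (TangentSpace 𝓘(ℝ, E) : M → Type _) x₀).symmL ℝ x

/-- The components of a bilinear form at `x` in the coordinate frame of the chart at `x₀`. -/
noncomputable def coordBilin (x₀ x : M) (b : E →L[ℝ] E →L[ℝ] ℝ) : E →L[ℝ] E →L[ℝ] ℝ :=
  b.bilinearComp (coordFrame x₀ x) (coordFrame x₀ x)

set_option synthInstance.maxHeartbeats 200000 in
theorem Tensor02.contMDiffAt_iff_coord (T : Tensor02 E M) {x₀ x : M}
    (hx : x ∈ (chartAt E x₀).source) :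
    ContMDiffAt 𝓘(ℝ, E) (𝓘(ℝ, E).prod 𝓘(ℝ, E →L[ℝ] E →L[ℝ] ℝ)) ∞ T.toTotal x ↔
      ContMDiffAt 𝓘(ℝ, E) 𝓘(ℝ, E →L[ℝ] E →L[ℝ] ℝ) ∞ (fun y ↦ coordBilin x₀ y (T y)) x := by
  let e := trivializationAt (E →L[ℝ] E →L[ℝ] ℝ)
    (fun x : M ↦ TangentSpace 𝓘(ℝ, E) x →L[ℝ] TangentSpace 𝓘(ℝ, E) x →L[ℝ] ℝ) x₀
  have hxe : x ∈ e.baseSet := by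
    simp [e, hom_trivializationAt_baseSet, hx]
  rw [e.contMDiffAt_section_iff (s := T) hxe]
  have : (fun y ↦ (e ⟨y, T y⟩).2) =ᶠ[𝓝 x] fun y ↦ coordBilin x₀ y (T y) := by
    filter_upwards [e.open_baseSet.mem_nhds hxe] with y hy
    ext v w
    have hy' : y ∈ (trivializationAt (E →L[ℝ] ℝ)
        (fun x : M ↦ TangentSpace 𝓘(ℝ, E) x →L[ℝ] ℝ) x₀).baseSet := hy.2
    simp only [e, hom_trivializationAt_apply, ContinuousLinearMap.inCoordinates,
      ContinuousLinearMap.comp_apply, Trivialization.continuousLinearMapAt_apply]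
    rw [Trivialization.coe_linearMapAt_of_mem _ hy']
    simp only [hom_trivializationAt_apply]
    simp [ContinuousLinearMap.inCoordinates]
    rfl
  exact this.contMDiffAt_iff

theorem OneForm.contMDiffAt_iff_coord (α : OneForm E M) {x₀ x : M}
    (hx : x ∈ (chartAt E x₀).source) :
    ContMDiffAt 𝓘(ℝ, E) (𝓘(ℝ, E).prod 𝓘(ℝ, E →L[ℝ] ℝ)) ∞
        (fun x ↦ (TotalSpace.mk' (E →L[ℝ] ℝ) x (α x) :
          TotalSpace (E →L[ℝ] ℝ) (fun x : M ↦ TangentSpace 𝓘(ℝ, E) x →L[ℝ] ℝ))) x ↔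
      ContMDiffAt 𝓘(ℝ, E) 𝓘(ℝ, E →L[ℝ] ℝ) ∞
        (fun y ↦ (α y : E →L[ℝ] ℝ).comp (coordFrame x₀ y)) x := by
  let e := trivializationAt (E →L[ℝ] ℝ) (fun x : M ↦ TangentSpace 𝓘(ℝ, E) x →L[ℝ] ℝ) x₀
  have hxe : x ∈ e.baseSet := by
    simp [e, hom_trivializationAt_baseSet, hx]
  rw [e.contMDiffAt_section_iff (s := α) hxe]
  have : (fun y ↦ (e ⟨y, α y⟩).2) =ᶠ[𝓝 x]
      fun y ↦ (α y : E →L[ℝ] ℝ).comp (coordFrame x₀ y) := by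
    filter_upwards [e.open_baseSet.mem_nhds hxe] with y hy
    ext v
    simp [e, hom_trivializationAt_apply, ContinuousLinearMap.inCoordinates, coordFrame]
  exact this.contMDiffAt_iff

/-- A field with constant components in the coordinate frame. -/
noncomputable def coordField (x₀ : M) (v : E) : VectField E M := fun x ↦
  coordFrame (E := E) x₀ x v

theorem contMDiffAt_coordField (x₀ : M) (v : E) {x : M} (hx : x ∈ (chartAt E x₀).source) :
    ContMDiffAt 𝓘(ℝ, E) (𝓘(ℝ, E).prod 𝓘(ℝ, E)) ∞
    (T% (coordField x₀ v)) x := by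
  let e := trivializationAt E (TangentSpace 𝓘(ℝ, E) : M → Type _) x₀
  have hxe : x ∈ e.baseSet := hx
  rw [e.contMDiffAt_section_iff (s := coordField x₀ v) hxe]
  have : (fun y ↦ (e ⟨y, coordField x₀ v y⟩).2) =ᶠ[𝓝 x] fun _ ↦ v := by
    filter_upwards [e.open_baseSet.mem_nhds hxe] with y hy
    have := e.continuousLinearMapAt_symmL (R := ℝ) hy v
    rw [Trivialization.continuousLinearMapAt_apply, e.coe_linearMapAt_of_mem hy] at this
    exact this
  exact this.contMDiffAt_iff.2 contMDiffAt_const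

theorem coordFrame_self (x : M) : coordFrame x x = ContinuousLinearMap.id ℝ E := by
  ext v
  rw [coordFrame, TangentBundle.symmL_trivializationAt_eq_core (mem_chart_source E x)]
  exact (tangentBundleCore 𝓘(ℝ, E) M).coordChange_self _ _ (mem_chart_source E x) v

/-- Coordinate fields commute. -/
theorem mlieBracket_coordField [CompleteSpace E] (x₀ : M) (v w : E) :
    VectorField.mlieBracket 𝓘(ℝ, E) (coordField x₀ v) (coordField x₀ w) x₀ = 0 := by
  have key : ∀ v : E, VectorField.mpullbackWithin 𝓘(ℝ, E) 𝓘(ℝ, E) (extChartAt 𝓘(ℝ, E) x₀).symm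
      (coordField x₀ v) (Set.range 𝓘(ℝ, E)) =ᶠ[𝓝 (extChartAt 𝓘(ℝ, E) x₀ x₀)] fun _ ↦ v := by
    intro v
    filter_upwards [extChartAt_target_mem_nhds (I := 𝓘(ℝ, E)) x₀] with z hz
    have hs : (extChartAt 𝓘(ℝ, E) x₀).symm z ∈ (chartAt E x₀).source := by
      simpa using (extChartAt 𝓘(ℝ, E) x₀).map_target hz
    have h1 := TangentBundle.symmL_trivializationAt (I := 𝓘(ℝ, E)) hs
    rw [(extChartAt 𝓘(ℝ, E) x₀).right_inv hz] at h1
    rw [VectorField.mpullbackWithin_apply]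
    have hinv := isInvertible_mfderivWithin_extChartAt_symm (I := 𝓘(ℝ, E)) hz
    exact hinv.inverse_apply_eq.2 congr($h1 v)
  rw [← VectorField.mlieBracketWithin_univ, VectorField.mlieBracketWithin_apply]
  have hz : ∀ {V W : E → E} {a b z : E}, V =ᶠ[𝓝 z] (fun _ ↦ a) → W =ᶠ[𝓝 z] (fun _ ↦ b) →
      VectorField.lieBracketWithin ℝ V W
        ((extChartAt 𝓘(ℝ, E) x₀).symm ⁻¹' Set.univ ∩ Set.range 𝓘(ℝ, E)) z = 0 := by
    intro V W a b z hV hW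
    have h0 : (extChartAt 𝓘(ℝ, E) x₀).symm ⁻¹' Set.univ ∩ Set.range 𝓘(ℝ, E) = Set.univ := by simp
    rw [h0, VectorField.lieBracketWithin_univ, hV.lieBracket_vectorField_eq hW]
    simp [VectorField.lieBracket]
  exact (congrArg _ (hz (key v) (key w))).trans (map_zero _)

end CoordinateFrame

section LeviCivita

variable {E : Type*} [NormedAddCommGroup E] [NormedSpace ℝ E] [FiniteDimensional ℝ E]
  {M : Type*} [TopologicalSpace M] [ChartedSpace E M] [IsManifold 𝓘(ℝ, E) ∞ M]

/-- The right-hand side of the Koszul formula for `2 g(∇_X Y, Z)`. -/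
noncomputable def koszulExpr (g : Tensor02 E M) (Y X Z : VectField E M) (x : M) : ℝ :=
  mvfderiv 𝓘(ℝ, E) (g.eval Y Z) x (X x) + mvfderiv 𝓘(ℝ, E) (g.eval X Z) x (Y x)
    - mvfderiv 𝓘(ℝ, E) (g.eval X Y) x (Z x)
    + g x (VectorField.mlieBracket 𝓘(ℝ, E) X Y x) (Z x)
    - g x (VectorField.mlieBracket 𝓘(ℝ, E) X Z x) (Y x)
    - g x (X x) (VectorField.mlieBracket 𝓘(ℝ, E) Y Z x)

variable {g : Tensor02 E M} {x : M}

theorem koszulExpr_tensorial_left (hg : g.IsSmooth) {Y Z : VectField E M}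
    (hY : MDiffAt (T% Y) x) (hZ : MDiffAt (T% Z) x) :
    TensorialAt 𝓘(ℝ, E) E (fun X ↦ koszulExpr g Y X Z x) x where
  smul {f X} hf hX := by
    have : CompleteSpace E := FiniteDimensional.complete ℝ E
    have hT := hg.mdifferentiableAt x
    simp only [koszulExpr, Tensor02.eval_smul_left]
    rw [mvfderiv_fun_mul hf (Tensor02.mdifferentiableAt_eval hT hX hZ),
      mvfderiv_fun_mul hf (Tensor02.mdifferentiableAt_eval hT hX hY),
      VectorField.mlieBracket_smul_left hf hX, VectorField.mlieBracket_smul_left hf hX]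
    simp [Tensor02.eval]
    ring
  add {X X'} hX hX' := by
    have : CompleteSpace E := FiniteDimensional.complete ℝ E
    have hT := hg.mdifferentiableAt x
    simp only [koszulExpr, Tensor02.eval_add_left]
    rw [mvfderiv_fun_add (Tensor02.mdifferentiableAt_eval hT hX hZ)
        (Tensor02.mdifferentiableAt_eval hT hX' hZ),
      mvfderiv_fun_add (Tensor02.mdifferentiableAt_eval hT hX hY)
        (Tensor02.mdifferentiableAt_eval hT hX' hY),
      VectorField.mlieBracket_add_left hX hX', VectorField.mlieBracket_add_left hX hX']
    simp
    ring

theorem koszulExpr_tensorial_right (hg : g.IsSmooth) (hs : g.IsSymm) {Y X : VectField E M}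
    (hY : MDiffAt (T% Y) x) (hX : MDiffAt (T% X) x) :
    TensorialAt 𝓘(ℝ, E) E (koszulExpr g Y X · x) x where
  smul {f Z} hf hZ := by
    have : CompleteSpace E := FiniteDimensional.complete ℝ E
    have hT := hg.mdifferentiableAt x
    simp only [koszulExpr, Tensor02.eval_smul_right]
    rw [mvfderiv_fun_mul hf (Tensor02.mdifferentiableAt_eval hT hX hZ),
      mvfderiv_fun_mul hf (Tensor02.mdifferentiableAt_eval hT hY hZ),
      VectorField.mlieBracket_smul_right hf hZ, VectorField.mlieBracket_smul_right hf hZ]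
    simp [Tensor02.eval, hs x (Z x) (Y x)]
    ring
  add {Z Z'} hZ hZ' := by
    have : CompleteSpace E := FiniteDimensional.complete ℝ E
    have hT := hg.mdifferentiableAt x
    simp only [koszulExpr, Tensor02.eval_add_right]
    rw [mvfderiv_fun_add (Tensor02.mdifferentiableAt_eval hT hY hZ)
        (Tensor02.mdifferentiableAt_eval hT hY hZ'),
      mvfderiv_fun_add (Tensor02.mdifferentiableAt_eval hT hX hZ)
        (Tensor02.mdifferentiableAt_eval hT hX hZ'),
      VectorField.mlieBracket_add_right hZ hZ', VectorField.mlieBracket_add_right hZ hZ']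
    simp
    ring

/-- Every bilinear form is represented by an endomorphism with respect to a non-degenerate one. -/
theorem exists_endomorphism_of_nondegenerate {V : Type*} [NormedAddCommGroup V] [NormedSpace ℝ V]
    [FiniteDimensional ℝ V] {b : V →L[ℝ] V →L[ℝ] ℝ}
    (hb : ∀ v, (∀ w, b v w = 0) → v = 0) (K : V →L[ℝ] V →L[ℝ] ℝ) :
    ∃ A : V →L[ℝ] V, ∀ v w, b (A v) w = K v w := by
  let L : V →ₗ[ℝ] (V →L[ℝ] ℝ) := b
  have hinj : Function.Injective L := by
    rw [injective_iff_map_eq_zero]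
    exact fun v hv ↦ hb v fun w ↦ congr($hv w)
  have hdim : Module.finrank ℝ V = Module.finrank ℝ (V →L[ℝ] ℝ) := by
    rw [← (LinearMap.toContinuousLinearMap (𝕜 := ℝ) (E := V) (F' := ℝ)).finrank_eq]
    exact (Subspace.dual_finrank_eq (K := ℝ) (V := V)).symm
  let e : V ≃ₗ[ℝ] (V →L[ℝ] ℝ) := LinearEquiv.ofInjectiveOfFinrankEq L hinj hdim
  refine ⟨LinearMap.toContinuousLinearMap (e.symm.toLinearMap ∘ₗ (K : V →ₗ[ℝ] (V →L[ℝ] ℝ))),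
    fun v w ↦ ?_⟩
  have : L (e.symm (K v)) = K v := e.apply_symm_apply (K v)
  exact congr($this w)

/-- The Koszul expression is tensorial in `X` and `Z`, so that it defines `∇Y` pointwise. -/
theorem exists_koszul_endomorphism (hg : g.IsSmooth) (hs : g.IsSymm)
    (hn : ∀ x v, (∀ w, g x v w = 0) → v = 0) (Y : VectField E M) (x : M)
    (hY : MDiffAt (T% Y) x) :
    ∃ A : TangentSpace 𝓘(ℝ, E) x →L[ℝ] TangentSpace 𝓘(ℝ, E) x,
      ∀ X Z : VectField E M, MDiffAt (T% X) x → MDiffAt (T% Z) x →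
        g x (A (X x)) (Z x) = (1 / 2) * koszulExpr g Y X Z x := by
  let K := TensorialAt.mkHom₂ (I := 𝓘(ℝ, E)) (F := E) (F' := E) (koszulExpr g Y · · x) x
    (fun Z hZ ↦ koszulExpr_tensorial_left hg hY hZ)
    (fun X hX ↦ koszulExpr_tensorial_right hg hs hY hX)
  obtain ⟨A, hA⟩ := exists_endomorphism_of_nondegenerate (V := E) (b := g x) (hn x)
    ((1 / 2 : ℝ) • (K : E →L[ℝ] E →L[ℝ] ℝ))
  refine ⟨A, fun X Z hX hZ ↦ (hA (X x) (Z x)).trans ?_⟩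
  have h1 : K (X x) (Z x) = koszulExpr g Y X Z x := TensorialAt.mkHom₂_apply _ _ hX hZ
  exact congrArg ((1 / 2 : ℝ) * ·) h1

open scoped Classical in
/-- The map `(Y, v) ↦ ∇_v Y` determined by the Koszul formula, extended by `0` to the points where
`Y` is not differentiable. -/
noncomputable def koszulConnection (hg : g.IsSmooth) (hs : g.IsSymm)
    (hn : ∀ x v, (∀ w, g x v w = 0) → v = 0) (Y : VectField E M) (x : M) :
    TangentSpace 𝓘(ℝ, E) x →L[ℝ] TangentSpace 𝓘(ℝ, E) x :=
  if hY : MDiffAt (T% Y) x then (exists_koszul_endomorphism hg hs hn Y x hY).choose else 0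

theorem koszulConnection_apply (hg : g.IsSmooth) (hs : g.IsSymm)
    (hn : ∀ x v, (∀ w, g x v w = 0) → v = 0) {X Y Z : VectField E M} {x : M}
    (hX : MDiffAt (T% X) x) (hY : MDiffAt (T% Y) x) (hZ : MDiffAt (T% Z) x) :
    g x (koszulConnection hg hs hn Y x (X x)) (Z x) = (1 / 2) * koszulExpr g Y X Z x := by
  rw [koszulConnection, dif_pos hY]
  exact (exists_koszul_endomorphism hg hs hn Y x hY).choose_spec X Z hX hZ

omit [FiniteDimensional ℝ E] in
/-- Two tangent vectors with the same products with all vector fields agree. -/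
theorem eq_of_forall_field (hn : ∀ x v, (∀ w, g x v w = 0) → v = 0) {x : M}
    {a b : TangentSpace 𝓘(ℝ, E) x}
    (h : ∀ Z : VectField E M, MDiffAt (T% Z) x → g x a (Z x) = g x b (Z x)) : a = b := by
  rw [← sub_eq_zero]
  refine hn x _ fun w ↦ ?_
  have := h (FiberBundle.extend E w) (FiberBundle.mdifferentiableAt_extend ..)
  simp only [FiberBundle.extend_apply_self] at this
  simp [this]

theorem koszulConnection_isCovariantDerivativeOn (hg : g.IsSmooth) (hs : g.IsSymm)
    (hn : ∀ x v, (∀ w, g x v w = 0) → v = 0) :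
    IsCovariantDerivativeOn E (koszulConnection hg hs hn) Set.univ := by
  have hE : CompleteSpace E := FiniteDimensional.complete ℝ E
  have hext : ∀ (x : M) (v : TangentSpace 𝓘(ℝ, E) x),
      ∃ X : VectField E M, MDiffAt (T% X) x ∧ X x = v := fun x v ↦
    ⟨FiberBundle.extend E v, FiberBundle.mdifferentiableAt_extend .., by simp⟩
  refine ⟨?_, ?_⟩
  · intro Y Y' x hY hY' _
    have hYY' : MDiffAt (T% (Y + Y')) x := mdifferentiableAt_add_section hY hY'
    have hT := hg.mdifferentiableAt x
    ext v
    obtain ⟨X, hX, rfl⟩ := hext x v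
    refine eq_of_forall_field hn fun Z hZ ↦ ?_
    rw [koszulConnection_apply hg hs hn hX hYY' hZ]
    simp only [add_apply, map_add]
    rw [koszulConnection_apply hg hs hn hX hY hZ,
      koszulConnection_apply hg hs hn hX hY' hZ]
    simp only [koszulExpr, Tensor02.eval_add_left, Tensor02.eval_add_right]
    rw [mvfderiv_fun_add (Tensor02.mdifferentiableAt_eval hT hY hZ)
        (Tensor02.mdifferentiableAt_eval hT hY' hZ),
      mvfderiv_fun_add (Tensor02.mdifferentiableAt_eval hT hX hY)
        (Tensor02.mdifferentiableAt_eval hT hX hY'),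
      VectorField.mlieBracket_add_left hY hY', VectorField.mlieBracket_add_right hY hY']
    simp
    ring
  · intro Y f x hY hf _
    have hfY : MDiffAt (T% (f • Y)) x := hf.smul_section hY
    have hT := hg.mdifferentiableAt x
    ext v
    obtain ⟨X, hX, rfl⟩ := hext x v
    refine eq_of_forall_field hn fun Z hZ ↦ ?_
    rw [koszulConnection_apply hg hs hn hX hfY hZ]
    simp only [add_apply, map_add, smul_apply, map_smul, ContinuousLinearMap.smulRight_apply]
    rw [koszulConnection_apply hg hs hn hX hY hZ]
    simp only [koszulExpr, Tensor02.eval_smul_left, Tensor02.eval_smul_right]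
    rw [mvfderiv_fun_mul hf (Tensor02.mdifferentiableAt_eval hT hY hZ),
      mvfderiv_fun_mul hf (Tensor02.mdifferentiableAt_eval hT hX hY),
      VectorField.mlieBracket_smul_left hf hY, VectorField.mlieBracket_smul_right hf hY]
    simp [Tensor02.eval]
    ring

/-- A smooth symmetric non-degenerate `g` has a Levi-Civita connection, by the Koszul formula. -/
theorem exists_isLeviCivita (hg : g.IsSmooth) (hs : g.IsSymm)
    (hn : ∀ x v, (∀ w, g x v w = 0) → v = 0) :
    ∃ cov : CovariantDerivative 𝓘(ℝ, E) E (TangentSpace 𝓘(ℝ, E) : M → Type _),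
      IsLeviCivita g cov := by
  have hE : CompleteSpace E := FiniteDimensional.complete ℝ E
  have hext : ∀ (x : M) (v : TangentSpace 𝓘(ℝ, E) x),
      ∃ X : VectField E M, MDiffAt (T% X) x ∧ X x = v := fun x v ↦
    ⟨FiberBundle.extend E v, FiberBundle.mdifferentiableAt_extend .., by simp⟩
  let cov : CovariantDerivative 𝓘(ℝ, E) E (TangentSpace 𝓘(ℝ, E) : M → Type _) :=
    ⟨koszulConnection hg hs hn, koszulConnection_isCovariantDerivativeOn hg hs hn⟩
  refine ⟨cov, ⟨?_, ?_⟩⟩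
  · intro X Y x hX hY
    change koszulConnection hg hs hn Y x (X x) - koszulConnection hg hs hn X x (Y x) = _
    refine eq_of_forall_field hn fun Z hZ ↦ ?_
    simp only [map_sub, sub_apply]
    rw [koszulConnection_apply hg hs hn hX hY hZ, koszulConnection_apply hg hs hn hY hX hZ]
    have h1 : g.eval X Y = g.eval Y X := by funext y; exact hs y _ _
    simp only [koszulExpr, h1]
    rw [VectorField.mlieBracket_swap_apply (V := Y) (W := X)]
    simp only [map_neg, neg_apply]
    rw [hs x (X x) (VectorField.mlieBracket 𝓘(ℝ, E) Y Z x),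
      hs x (Y x) (VectorField.mlieBracket 𝓘(ℝ, E) X Z x)]
    ring
  · intro Y Z x v hY hZ
    obtain ⟨X, hX, rfl⟩ := hext x v
    change _ = g x (koszulConnection hg hs hn Y x (X x)) (Z x) +
      g x (Y x) (koszulConnection hg hs hn Z x (X x))
    rw [hs x (Y x) (koszulConnection hg hs hn Z x (X x))]
    rw [koszulConnection_apply hg hs hn hX hY hZ, koszulConnection_apply hg hs hn hX hZ hY]
    have h1 : g.eval Y Z = g.eval Z Y := by funext y; exact hs y _ _
    simp only [koszulExpr, h1]
    rw [VectorField.mlieBracket_swap_apply (V := Z) (W := Y)]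
    simp only [map_neg]
    ring

/-- A field along which the metric satisfies `(𝓛_ξ g)(ξ, ·) = ½ d(g(ξ, ξ))` is geodesic. -/
theorem isGeodesicField_of_lieDeriv (hg : g.IsSmooth) (hs : g.IsSymm)
    (hn : ∀ x v, (∀ w, g x v w = 0) → v = 0) {ξ : VectField E M} (hξ : ξ.IsSmooth)
    (h : ∀ x w, lieDeriv ξ g x (ξ x) w = (1 / 2) * mvfderiv 𝓘(ℝ, E) (g.eval ξ ξ) x w) :
    IsGeodesicField g ξ := by
  obtain ⟨cov, hcov⟩ := exists_isLeviCivita hg hs hn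
  refine ⟨cov, hcov, fun x ↦ hn x _ fun w ↦ ?_⟩
  have hξx : MDiffAt (T% ξ) x := (hξ x).mdifferentiableAt (by simp)
  let Z : VectField E M := FiberBundle.extend E w
  have hZ : MDiffAt (T% Z) x := FiberBundle.mdifferentiableAt_extend ..
  have hZx : Z x = w := by simp [Z]
  have h1 := h x (Z x)
  rw [lieDeriv_apply (hg.mdifferentiableAt x) hξx hZ, VectorField.mlieBracket_self,
    hcov.compatible ξ Z x (ξ x) hξx hZ, hcov.compatible ξ ξ x (Z x) hξx hξx,
    ← hcov.torsion_free ξ Z x hξx hZ] at h1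
  rw [hs x (cov ξ x (Z x)) (ξ x)] at h1
  simp only [Pi.zero_apply, map_zero, zero_apply, map_sub] at h1
  rw [← hZx]
  linarith

end LeviCivita

/-! ### The cylinder over a manifold -/

section PullBilin

variable {V V' : Type*} [NormedAddCommGroup V] [NormedSpace ℝ V]
  [NormedAddCommGroup V'] [NormedSpace ℝ V']

/-- The pullback `b ↦ b(f ·, f ·)` of bilinear forms, as a continuous linear map. -/
noncomputable def pullBilin (f : V →L[ℝ] V') : (V' →L[ℝ] V' →L[ℝ] ℝ) →L[ℝ] (V →L[ℝ] V →L[ℝ] ℝ) :=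
  (ContinuousLinearMap.compL ℝ V (V' →L[ℝ] ℝ) (V →L[ℝ] ℝ)
    ((ContinuousLinearMap.compL ℝ V V' ℝ).flip f)).comp
    ((ContinuousLinearMap.compL ℝ V V' (V' →L[ℝ] ℝ)).flip f)

@[simp] theorem pullBilin_apply (f : V →L[ℝ] V') (b : V' →L[ℝ] V' →L[ℝ] ℝ) (v w : V) :
    pullBilin f b v w = b (f v) (f w) := rfl

end PullBilin

/-- The cylinder `ℝ × H`. A type of its own, so that its charts take values in `ℝ × E` and not in
`ModelProd ℝ E`. -/
def Cylinder (H : Type*) : Type _ := ℝ × H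

section Cylinder

variable {E : Type*} [NormedAddCommGroup E] [NormedSpace ℝ E]
  {H : Type*} [TopologicalSpace H] [ChartedSpace E H]

instance : TopologicalSpace (Cylinder H) := inferInstanceAs (TopologicalSpace (ℝ × H))

instance [T2Space H] : T2Space (Cylinder H) := inferInstanceAs (T2Space (ℝ × H))

instance [SecondCountableTopology H] : SecondCountableTopology (Cylinder H) :=
  inferInstanceAs (SecondCountableTopology (ℝ × H))

noncomputable instance : ChartedSpace (ℝ × E) (Cylinder H) :=
  inferInstanceAs (ChartedSpace (ModelProd ℝ E) (ℝ × H))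

instance [IsManifold 𝓘(ℝ, E) ∞ H] : IsManifold 𝓘(ℝ, ℝ × E) ∞ (Cylinder H) := by
  have h := IsManifold.prod (n := ∞) (I := 𝓘(ℝ, ℝ)) (I' := 𝓘(ℝ, E)) ℝ H
  rw [← modelWithCornersSelf_prod] at h
  exact h

variable {U : TopologicalSpace.Opens (Cylinder H)}

theorem Cylinder.extChartAt_apply (x y : U) :
    extChartAt 𝓘(ℝ, ℝ × E) x y = (y.1.1, extChartAt 𝓘(ℝ, E) x.1.2 y.1.2) := rfl

omit [NormedSpace ℝ E] in
theorem Cylinder.mem_source_iff {x y : U} :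
    y ∈ (chartAt (ℝ × E) x).source ↔ y.1.2 ∈ (chartAt E x.1.2).source := by
  rw [TopologicalSpace.Opens.chartAt_eq, OpenPartialHomeomorph.subtypeRestr_source]
  change (y.1.1, y.1.2) ∈ ((chartAt ℝ x.1.1).prod (chartAt E x.1.2)).source ↔ _
  rw [OpenPartialHomeomorph.prod_source]
  exact ⟨fun h ↦ h.2, fun h ↦ ⟨Set.mem_univ _, h⟩⟩

theorem Cylinder.extChartAt_symm_eventually (x₀ x : U) (hx : x ∈ (chartAt (ℝ × E) x₀).source) :
    ∀ᶠ z in 𝓝 (extChartAt 𝓘(ℝ, ℝ × E) x₀ x),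
      ((extChartAt 𝓘(ℝ, ℝ × E) x₀).symm z).1 =
        (z.1, (extChartAt 𝓘(ℝ, E) x₀.1.2).symm z.2) := by
  have hx' : x ∈ (extChartAt 𝓘(ℝ, ℝ × E) x₀).source := by simpa using hx
  filter_upwards [extChartAt_target_mem_nhds' (I := 𝓘(ℝ, ℝ × E))
    ((extChartAt 𝓘(ℝ, ℝ × E) x₀).map_source hx')] with z hz
  have h1 := (extChartAt 𝓘(ℝ, ℝ × E) x₀).right_inv hz
  have h2 : (extChartAt 𝓘(ℝ, ℝ × E) x₀).symm z ∈ (chartAt (ℝ × E) x₀).source := by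
    simpa using (extChartAt 𝓘(ℝ, ℝ × E) x₀).map_target hz
  rw [Cylinder.mem_source_iff, ← extChartAt_source 𝓘(ℝ, E)] at h2
  rw [Cylinder.extChartAt_apply] at h1
  have h3 := (extChartAt 𝓘(ℝ, E) x₀.1.2).left_inv h2
  have h4 : (extChartAt 𝓘(ℝ, E) x₀.1.2) ((extChartAt 𝓘(ℝ, ℝ × E) x₀).symm z).1.2 = z.2 :=
    congrArg Prod.snd h1
  rw [h4] at h3
  have h5 : ((extChartAt 𝓘(ℝ, ℝ × E) x₀).symm z).1.1 = z.1 := congrArg Prod.fst h1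
  exact Prod.ext h5 h3.symm

theorem Cylinder.hasMFDerivAt_snd (x : U) :
    HasMFDerivAt 𝓘(ℝ, ℝ × E) 𝓘(ℝ, E) (fun y : U ↦ y.1.2) x (ContinuousLinearMap.snd ℝ ℝ E) := by
  refine ⟨((continuous_snd (X := ℝ) (Y := H)).comp continuous_subtype_val).continuousAt, ?_⟩
  rw [modelWithCornersSelf_coe, Set.range_id]
  refine HasFDerivAt.hasFDerivWithinAt ?_
  refine (hasFDerivAt_snd (𝕜 := ℝ) (E := ℝ) (F := E)).congr_of_eventuallyEq ?_
  filter_upwards [extChartAt_target_mem_nhds (I := 𝓘(ℝ, ℝ × E)) x] with z hz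
  have h1 := (extChartAt 𝓘(ℝ, ℝ × E) x).right_inv hz
  rw [Cylinder.extChartAt_apply] at h1
  exact congrArg Prod.snd h1

section Frame

variable [IsManifold 𝓘(ℝ, E) ∞ H]

theorem coordFrame_eq_tangentCoordChange {p₀ p : H} (hp : p ∈ (chartAt E p₀).source) :
    coordFrame (E := E) p₀ p = tangentCoordChange 𝓘(ℝ, E) p₀ p p := by
  rw [coordFrame, TangentBundle.symmL_trivializationAt_eq_core hp]

theorem exists_equiv_coordFrame {p₀ p : H} (hp : p ∈ (chartAt E p₀).source) :
    ∃ e : E ≃L[ℝ] E, (e : E →L[ℝ] E) = coordFrame p₀ p := by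
  have hp' : p ∈ (extChartAt 𝓘(ℝ, E) p₀).source := by simpa using hp
  have := isInvertible_mfderivWithin_extChartAt_symm (I := 𝓘(ℝ, E))
    ((extChartAt 𝓘(ℝ, E) p₀).map_source hp')
  rw [← TangentBundle.symmL_trivializationAt (I := 𝓘(ℝ, E)) hp] at this
  exact this

/-- The coordinate frames of the cylinder are those of `H`, completed by the direction of `ℝ`. -/
theorem Cylinder.coordFrame_eq {x₀ x : U} (hx : x ∈ (chartAt (ℝ × E) x₀).source) :
    coordFrame (E := ℝ × E) x₀ x =
      (ContinuousLinearMap.id ℝ ℝ).prodMap (coordFrame (E := E) x₀.1.2 x.1.2) := by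
  have hp := Cylinder.mem_source_iff.1 hx
  rw [coordFrame_eq_tangentCoordChange hx, coordFrame_eq_tangentCoordChange hp,
    tangentCoordChange_def]
  have h1 := hasFDerivWithinAt_tangentCoordChange (I := 𝓘(ℝ, E)) (x := x₀.1.2) (y := x.1.2)
    (z := x.1.2) ⟨by simpa using hp, by simp⟩
  simp only [modelWithCornersSelf_coe, Set.range_id, hasFDerivWithinAt_univ] at h1
  have h2 := (hasFDerivAt_id (𝕜 := ℝ) x.1.1).prodMap
    (p := (x.1.1, extChartAt 𝓘(ℝ, E) x₀.1.2 x.1.2)) h1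
  have h3 : (extChartAt 𝓘(ℝ, ℝ × E) x ∘ (extChartAt 𝓘(ℝ, ℝ × E) x₀).symm)
      =ᶠ[𝓝 (extChartAt 𝓘(ℝ, ℝ × E) x₀ x)]
      Prod.map id (extChartAt 𝓘(ℝ, E) x.1.2 ∘ (extChartAt 𝓘(ℝ, E) x₀.1.2).symm) := by
    filter_upwards [Cylinder.extChartAt_symm_eventually x₀ x hx] with z hz
    simp only [Function.comp_apply, Cylinder.extChartAt_apply, hz, Prod.map, id]
  simp only [modelWithCornersSelf_coe, Set.range_id, fderivWithin_univ]
  exact (h2.congr_of_eventuallyEq h3).fderiv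

end Frame

variable (hU : ∀ p : H, ((0, p) : ℝ × H) ∈ (U : Set (Cylinder H)))

/-- The embedding of `H` as the zero section of the cylinder. -/
def Cylinder.zeroSection (hU : ∀ p : H, ((0, p) : ℝ × H) ∈ (U : Set (Cylinder H))) (p : H) : U :=
  ⟨((0, p) : ℝ × H), hU p⟩

theorem Cylinder.isEmbedding_zeroSection : IsEmbedding (Cylinder.zeroSection hU) := by
  have h1 : Continuous (Cylinder.zeroSection hU) :=
    Continuous.subtype_mk (f := fun p : H ↦ ((0, p) : ℝ × H)) (by fun_prop) _
  have h2 : Continuous fun y : U ↦ y.1.2 :=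
    (continuous_snd (X := ℝ) (Y := H)).comp continuous_subtype_val
  exact IsEmbedding.of_leftInverse (f := fun y : U ↦ y.1.2) (fun p ↦ rfl) h2 h1

theorem Cylinder.hasMFDerivAt_zeroSection (p : H) :
    HasMFDerivAt 𝓘(ℝ, E) 𝓘(ℝ, ℝ × E) (Cylinder.zeroSection hU) p
      (ContinuousLinearMap.inr ℝ ℝ E) := by
  refine ⟨(Cylinder.isEmbedding_zeroSection hU).continuous.continuousAt, ?_⟩
  rw [modelWithCornersSelf_coe, Set.range_id]
  refine HasFDerivAt.hasFDerivWithinAt ?_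
  refine ((ContinuousLinearMap.inr ℝ ℝ E).hasFDerivAt).congr_of_eventuallyEq ?_
  filter_upwards [extChartAt_target_mem_nhds (I := 𝓘(ℝ, E)) p] with z hz
  have h1 := (extChartAt 𝓘(ℝ, E) p).right_inv hz
  exact Prod.ext rfl h1

theorem Cylinder.isSmoothEmbedding_zeroSection [IsManifold 𝓘(ℝ, E) ∞ H] :
    Manifold.IsSmoothEmbedding 𝓘(ℝ, E) 𝓘(ℝ, ℝ × E) ∞ (Cylinder.zeroSection hU) := by
  refine ⟨?_, Cylinder.isEmbedding_zeroSection hU⟩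
  refine Manifold.IsImmersionOfComplement.isImmersion (F := ℝ) fun p ↦ ?_
  refine Manifold.IsImmersionAtOfComplement.mk_of_continuousAt
    (Cylinder.isEmbedding_zeroSection hU).continuous.continuousAt
    (ContinuousLinearEquiv.prodComm ℝ E ℝ) (chartAt E p)
    (chartAt (ℝ × E) (Cylinder.zeroSection hU p)) (mem_chart_source E p)
    (mem_chart_source _ _) (IsManifold.chart_mem_maximalAtlas p)
    (IsManifold.chart_mem_maximalAtlas _) ?_
  intro z hz
  exact Prod.ext rfl ((extChartAt 𝓘(ℝ, E) p).right_inv hz)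

end Cylinder

/-! ### Families of bilinear forms as tensor fields on the cylinder -/

theorem lieDeriv_apply_of_mlieBracket_eq_zero {E : Type*} [NormedAddCommGroup E] [NormedSpace ℝ E]
    [FiniteDimensional ℝ E] {M : Type*} [TopologicalSpace M] [ChartedSpace E M]
    [IsManifold 𝓘(ℝ, E) ∞ M] {ξ X Y : VectField E M} {T : Tensor02 E M} {x : M}
    (hT : MDifferentiableAt 𝓘(ℝ, E) (𝓘(ℝ, E).prod 𝓘(ℝ, E →L[ℝ] E →L[ℝ] ℝ)) T.toTotal x)
    (hX : MDiffAt (T% X) x) (hY : MDiffAt (T% Y) x)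
    (hξX : VectorField.mlieBracket 𝓘(ℝ, E) ξ X x = 0)
    (hξY : VectorField.mlieBracket 𝓘(ℝ, E) ξ Y x = 0) :
    lieDeriv ξ T x (X x) (Y x) = mvfderiv 𝓘(ℝ, E) (T.eval X Y) x (ξ x) := by
  rw [lieDeriv_apply hT hX hY, hξX, hξY]
  simp

theorem MDifferentiableAt.hasFDerivAt_comp_extChartAt_symm {E : Type*} [NormedAddCommGroup E]
    [NormedSpace ℝ E] {M : Type*} [TopologicalSpace M] [ChartedSpace E M] {f : M → ℝ} {x : M}
    (hf : MDifferentiableAt 𝓘(ℝ, E) 𝓘(ℝ) f x) :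
    HasFDerivAt (fun z ↦ f ((extChartAt 𝓘(ℝ, E) x).symm z))
      (mvfderiv 𝓘(ℝ, E) f x : E →L[ℝ] ℝ) (extChartAt 𝓘(ℝ, E) x x) := by
  have h := hf.hasMFDerivAt.2
  rw [modelWithCornersSelf_coe, Set.range_id] at h
  exact hasFDerivWithinAt_univ.1 h

section SmoothFamily

variable {E : Type*} [NormedAddCommGroup E] [NormedSpace ℝ E]
  {H : Type*} [TopologicalSpace H] [ChartedSpace E H] [IsManifold 𝓘(ℝ, E) ∞ H]

/-- The components of a bilinear form on `ℝ × T_pH` in the coordinate frame of the chart at `p₀`,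
completed by the direction of `ℝ`. -/
noncomputable def cylBilin (p₀ p : H) :
    ((ℝ × E) →L[ℝ] (ℝ × E) →L[ℝ] ℝ) →L[ℝ] ((ℝ × E) →L[ℝ] (ℝ × E) →L[ℝ] ℝ) :=
  pullBilin ((ContinuousLinearMap.id ℝ ℝ).prodMap (coordFrame (E := E) p₀ p))

/-- The components of a family of bilinear forms, as a function on an open subset of the model space
`ℝ × E`. -/
noncomputable def familyCoord (B : ℝ → H → (ℝ × E) →L[ℝ] (ℝ × E) →L[ℝ] ℝ) (p₀ : H) (z : ℝ × E) :
    (ℝ × E) →L[ℝ] (ℝ × E) →L[ℝ] ℝ :=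
  cylBilin (E := E) p₀ ((extChartAt 𝓘(ℝ, E) p₀).symm z.2) (B z.1 ((extChartAt 𝓘(ℝ, E) p₀).symm z.2))

/-- A family of bilinear forms on the spaces `ℝ × T_pH`, depending on `r ∈ ℝ` and `p ∈ H`, is
smooth if near every `p` its components in some chart are smooth functions of `(r, p)`, for all
values of `r`. -/
def SmoothFamily (B : ℝ → H → (ℝ × E) →L[ℝ] (ℝ × E) →L[ℝ] ℝ) : Prop :=
  ∀ p, ∃ p₀, p ∈ (chartAt E p₀).source ∧
    ∀ r, ContDiffAt ℝ ∞ (familyCoord B p₀) (r, extChartAt 𝓘(ℝ, E) p₀ p)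

/-- The derivative of a family of bilinear forms in the direction of `ℝ`. -/
noncomputable def familyDeriv (B : ℝ → H → (ℝ × E) →L[ℝ] (ℝ × E) →L[ℝ] ℝ) (r : ℝ) (p : H) :
    (ℝ × E) →L[ℝ] (ℝ × E) →L[ℝ] ℝ :=
  deriv (fun r ↦ B r p) r

/-- The tensor field on an open subset of the cylinder defined by a family of bilinear forms. -/
def familyTensor (U : TopologicalSpace.Opens (Cylinder H))
    (B : ℝ → H → (ℝ × E) →L[ℝ] (ℝ × E) →L[ℝ] ℝ) : Tensor02 (ℝ × E) U :=
  fun x ↦ B x.1.1 x.1.2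

variable (E) in
/-- The coordinate vector field in the direction of `ℝ`. -/
def radialField (U : TopologicalSpace.Opens (Cylinder H)) : VectField (ℝ × E) U :=
  fun _ ↦ ((1, 0) : ℝ × E)

variable {B : ℝ → H → (ℝ × E) →L[ℝ] (ℝ × E) →L[ℝ] ℝ}

theorem exists_equiv_cylFrame {p₀ p : H} (hp : p ∈ (chartAt E p₀).source) :
    ∃ e : (ℝ × E) ≃L[ℝ] (ℝ × E), (e : (ℝ × E) →L[ℝ] (ℝ × E)) =
      (ContinuousLinearMap.id ℝ ℝ).prodMap (coordFrame (E := E) p₀ p) := by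
  obtain ⟨e, he⟩ := exists_equiv_coordFrame hp
  exact ⟨(ContinuousLinearEquiv.refl ℝ ℝ).prodCongr e, by rw [← he]; rfl⟩

/-- For a fixed point of `H` a smooth family is a smooth curve of bilinear forms. -/
theorem SmoothFamily.contDiff (hB : SmoothFamily B) (p : H) : ContDiff ℝ ∞ fun r ↦ B r p := by
  rw [contDiff_iff_contDiffAt]
  intro r
  obtain ⟨p₀, hp, h⟩ := hB p
  obtain ⟨e, he⟩ := exists_equiv_cylFrame hp
  have hp' : p ∈ (extChartAt 𝓘(ℝ, E) p₀).source := by simpa using hp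
  have h1 : ContDiffAt ℝ ∞ (fun r ↦ familyCoord B p₀ (r, extChartAt 𝓘(ℝ, E) p₀ p)) r :=
    (h r).comp r (contDiffAt_id.prodMk contDiffAt_const)
  have h2 : (fun r ↦ B r p) = fun r ↦ pullBilin (e.symm : (ℝ × E) →L[ℝ] (ℝ × E))
      (familyCoord B p₀ (r, extChartAt 𝓘(ℝ, E) p₀ p)) := by
    funext r
    refine ContinuousLinearMap.ext fun v ↦ ContinuousLinearMap.ext fun w ↦ ?_
    simp only [familyCoord, cylBilin, ← he, pullBilin_apply,
      (extChartAt 𝓘(ℝ, E) p₀).left_inv hp']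
    simp
  rw [h2]
  exact (pullBilin (V := ℝ × E) (V' := ℝ × E) _).contDiff.contDiffAt.comp r h1

theorem familyCoord_familyDeriv (hB : SmoothFamily B) (p₀ : H) (z : ℝ × E)
    (hz : DifferentiableAt ℝ (familyCoord B p₀) z) :
    familyCoord (familyDeriv B) p₀ z = fderiv ℝ (familyCoord B p₀) z (1, 0) := by
  have h1 : HasDerivAt (fun r ↦ familyCoord B p₀ (r, z.2)) (fderiv ℝ (familyCoord B p₀) z (1, 0))
      z.1 :=
    HasFDerivAt.comp_hasDerivAt (f := fun r ↦ (r, z.2)) (l := familyCoord B p₀) z.1 hz.hasFDerivAt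
      ((hasDerivAt_id z.1).prodMk (hasDerivAt_const z.1 z.2))
  have h2 : HasDerivAt (fun r ↦ familyCoord B p₀ (r, z.2)) (familyCoord (familyDeriv B) p₀ z) z.1 :=
    (cylBilin (E := E) p₀ ((extChartAt 𝓘(ℝ, E) p₀).symm z.2)).hasFDerivAt.comp_hasDerivAt z.1
      (((hB.contDiff ((extChartAt 𝓘(ℝ, E) p₀).symm z.2)).differentiable (by simp)) z.1).hasDerivAt
  exact h2.unique h1

theorem SmoothFamily.familyDeriv (hB : SmoothFamily B) : SmoothFamily (familyDeriv B) := by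
  intro p
  obtain ⟨p₀, hp, h⟩ := hB p
  refine ⟨p₀, hp, fun r ↦ ?_⟩
  have h1 : ContDiffAt ℝ ∞ (fun z ↦ fderiv ℝ (familyCoord B p₀) z (1, 0))
      (r, extChartAt 𝓘(ℝ, E) p₀ p) :=
    ((h r).fderiv_right (m := ∞) (by simp)).clm_apply contDiffAt_const
  refine h1.congr_of_eventuallyEq ?_
  have h2 := ((h r).of_le (m := 1) (by exact_mod_cast le_top)).eventually (by simp)
  filter_upwards [h2] with z hz
  exact familyCoord_familyDeriv hB p₀ z (hz.differentiableAt (by simp))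

variable {U : TopologicalSpace.Opens (Cylinder H)}

theorem coordBilin_familyTensor {x₀ x : U} (hx : x ∈ (chartAt (ℝ × E) x₀).source) :
    coordBilin (E := ℝ × E) x₀ x (familyTensor U B x) =
      familyCoord B x₀.1.2 (extChartAt 𝓘(ℝ, ℝ × E) x₀ x) := by
  have hp : x.1.2 ∈ (extChartAt 𝓘(ℝ, E) x₀.1.2).source := by
    simpa using Cylinder.mem_source_iff.1 hx
  rw [familyCoord, Cylinder.extChartAt_apply]
  simp only [(extChartAt 𝓘(ℝ, E) x₀.1.2).left_inv hp]
  refine ContinuousLinearMap.ext fun v ↦ ContinuousLinearMap.ext fun w ↦ ?_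
  change familyTensor U B x (coordFrame (E := ℝ × E) x₀ x v) (coordFrame (E := ℝ × E) x₀ x w) = _
  rw [Cylinder.coordFrame_eq hx]
  rfl

theorem SmoothFamily.familyTensor_isSmooth (hB : SmoothFamily B)
    (hU : ∀ p : H, ((0, p) : ℝ × H) ∈ (U : Set (Cylinder H))) : (familyTensor U B).IsSmooth := by
  intro x
  obtain ⟨p₀, hp, h⟩ := hB x.1.2
  let x₀ : U := Cylinder.zeroSection hU p₀
  have hx : x ∈ (chartAt (ℝ × E) x₀).source := Cylinder.mem_source_iff.2 hp
  rw [(familyTensor U B).contMDiffAt_iff_coord hx]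
  have h1 : (fun y ↦ coordBilin x₀ y (familyTensor U B y)) =ᶠ[𝓝 x]
      familyCoord B p₀ ∘ extChartAt 𝓘(ℝ, ℝ × E) x₀ := by
    filter_upwards [(chartAt (ℝ × E) x₀).open_source.mem_nhds hx] with y hy
    exact coordBilin_familyTensor hy
  refine ContMDiffAt.congr_of_eventuallyEq ?_ h1
  have h2 : ContMDiffAt 𝓘(ℝ, ℝ × E) 𝓘(ℝ, (ℝ × E) →L[ℝ] (ℝ × E) →L[ℝ] ℝ) ∞ (familyCoord B p₀)
      (extChartAt 𝓘(ℝ, ℝ × E) x₀ x) := (h x.1.1).contMDiffAt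
  exact h2.comp x (contMDiffAt_extChartAt' (by simpa using hx))

theorem radialField_eventuallyEq (x : U) :
    radialField E U =ᶠ[𝓝 x] coordField x ((1, 0) : ℝ × E) := by
  filter_upwards [(chartAt (ℝ × E) x).open_source.mem_nhds (mem_chart_source _ x)] with y hy
  change ((1, 0) : ℝ × E) = coordFrame (E := ℝ × E) x y (1, 0)
  rw [Cylinder.coordFrame_eq hy]
  simp

theorem radialField_isSmooth : (radialField E U).IsSmooth := by
  intro x
  refine (contMDiffAt_coordField x ((1, 0) : ℝ × E) (mem_chart_source _ x)).congr_of_eventuallyEq ?_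
  filter_upwards [radialField_eventuallyEq (E := E) x] with y hy
  rw [hy]

/-- The Lie derivative along the direction of `ℝ` is the derivative of the family of bilinear
forms, because the coordinate fields commute. -/
theorem lieDeriv_familyTensor [FiniteDimensional ℝ E] (hB : SmoothFamily B)
    (hU : ∀ p : H, ((0, p) : ℝ × H) ∈ (U : Set (Cylinder H))) :
    lieDeriv (radialField E U) (familyTensor U B) = familyTensor U (familyDeriv B) := by
  have hE : CompleteSpace E := FiniteDimensional.complete ℝ E
  funext x
  have hT := (hB.familyTensor_isSmooth hU).mdifferentiableAt x
  refine ContinuousLinearMap.ext fun (v : ℝ × E) ↦ ContinuousLinearMap.ext fun (w : ℝ × E) ↦ ?_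
  have hX : ∀ v : ℝ × E, MDifferentiableAt 𝓘(ℝ, ℝ × E) (𝓘(ℝ, ℝ × E).prod 𝓘(ℝ, ℝ × E))
      (T% (coordField (E := ℝ × E) x v)) x := fun v ↦
    (contMDiffAt_coordField x v (mem_chart_source _ x)).mdifferentiableAt (by simp)
  have hXx : ∀ v : ℝ × E, coordField (E := ℝ × E) x v x = v := fun v ↦ by
    change coordFrame (E := ℝ × E) x x v = v
    rw [coordFrame_self]; rfl
  have hbr : ∀ v : ℝ × E, VectorField.mlieBracket 𝓘(ℝ, ℝ × E) (radialField E U)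
      (coordField (E := ℝ × E) x v) x = 0 := fun v ↦
    ((radialField_eventuallyEq (E := E) x).mlieBracket_vectorField_eq
      (EventuallyEq.refl _ _)).trans (mlieBracket_coordField (E := ℝ × E) x (1, 0) v)
  have h1 := lieDeriv_apply_of_mlieBracket_eq_zero (ξ := radialField E U) hT (hX v) (hX w)
    (hbr v) (hbr w)
  rw [hXx, hXx] at h1
  refine h1.trans ?_
  -- Along the curve `s ↦ (s, p)` the fields have constant components, and `T` takes the values
  -- `B s p v w`.
  have hd := (Tensor02.mdifferentiableAt_eval hT (hX v) (hX w)).hasFDerivAt_comp_extChartAt_symm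
  set f : U → ℝ := (familyTensor U B).eval (coordField (E := ℝ × E) x v)
    (coordField (E := ℝ × E) x w) with hf
  have hc : HasDerivAt (fun s ↦ f ((extChartAt 𝓘(ℝ, ℝ × E) x).symm
      (s, extChartAt 𝓘(ℝ, E) x.1.2 x.1.2))) (mvfderiv 𝓘(ℝ, ℝ × E) f x ((1, 0) : ℝ × E)) x.1.1 :=
    HasFDerivAt.comp_hasDerivAt (f := fun s ↦ (s, extChartAt 𝓘(ℝ, E) x.1.2 x.1.2)) x.1.1 hd
      ((hasDerivAt_id x.1.1).prodMk (hasDerivAt_const x.1.1 (extChartAt 𝓘(ℝ, E) x.1.2 x.1.2)))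
  have hev : (fun s ↦ B s x.1.2 v w) =ᶠ[𝓝 x.1.1] fun s ↦ f ((extChartAt 𝓘(ℝ, ℝ × E) x).symm
      (s, extChartAt 𝓘(ℝ, E) x.1.2 x.1.2)) := by
    have ht : Tendsto (fun s : ℝ ↦ (s, extChartAt 𝓘(ℝ, E) x.1.2 x.1.2)) (𝓝 x.1.1)
        (𝓝 (extChartAt 𝓘(ℝ, ℝ × E) x x)) :=
      (Continuous.prodMk_left (Y := E) (X := ℝ) (extChartAt 𝓘(ℝ, E) x.1.2 x.1.2)).tendsto x.1.1
    filter_upwards [ht.eventually (Cylinder.extChartAt_symm_eventually x x (mem_chart_source _ x))]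
      with s hs
    have hs' : ((extChartAt 𝓘(ℝ, ℝ × E) x).symm (s, extChartAt 𝓘(ℝ, E) x.1.2 x.1.2)).1 =
        (s, x.1.2) := by
      rw [hs, extChartAt_to_inv]
    have hy : (extChartAt 𝓘(ℝ, ℝ × E) x).symm (s, extChartAt 𝓘(ℝ, E) x.1.2 x.1.2) ∈
        (chartAt (ℝ × E) x).source := by
      rw [Cylinder.mem_source_iff, hs']
      exact mem_chart_source E x.1.2
    have hcf : ∀ u : ℝ × E, coordField (E := ℝ × E) x u
        ((extChartAt 𝓘(ℝ, ℝ × E) x).symm (s, extChartAt 𝓘(ℝ, E) x.1.2 x.1.2)) = u := fun u ↦ by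
      change coordFrame (E := ℝ × E) x _ u = u
      rw [Cylinder.coordFrame_eq hy, hs', coordFrame_self]
      rfl
    change B s x.1.2 v w = familyTensor U B _ (coordField (E := ℝ × E) x v _)
      (coordField (E := ℝ × E) x w _)
    rw [hcf, hcf, familyTensor, hs']
    rfl
  have hB' : HasDerivAt (fun s ↦ B s x.1.2 v w) (familyDeriv B x.1.1 x.1.2 v w) x.1.1 := by
    have h := ((hB.contDiff x.1.2).differentiable (by simp) x.1.1).hasDerivAt
    simpa [familyDeriv] using
      (h.clm_apply (hasDerivAt_const x.1.1 v)).clm_apply (hasDerivAt_const x.1.1 w)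
  exact (hc.congr_of_eventuallyEq hev).unique hB'

theorem lieDeriv_iterate_familyTensor [FiniteDimensional ℝ E] (hB : SmoothFamily B)
    (hU : ∀ p : H, ((0, p) : ℝ × H) ∈ (U : Set (Cylinder H))) (k : ℕ) :
    (lieDeriv (radialField E U))^[k] (familyTensor U B) = familyTensor U (familyDeriv^[k] B) := by
  induction k generalizing B with
  | zero => rfl
  | succ k ih => rw [Function.iterate_succ_apply, Function.iterate_succ_apply,
      lieDeriv_familyTensor hB hU, ih hB.familyDeriv]

theorem familyDeriv_iterate_apply (hB : SmoothFamily B) (k : ℕ) (r : ℝ) (p : H) (v w : ℝ × E) :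
    familyDeriv^[k] B r p v w = iteratedDeriv k (fun r ↦ B r p v w) r := by
  induction k generalizing B with
  | zero => simp
  | succ k ih =>
    rw [Function.iterate_succ_apply, ih hB.familyDeriv, iteratedDeriv_succ']
    congr 1
    funext r
    have h := ((hB.contDiff p).differentiable (by simp) r).hasDerivAt
    have h1 := (h.clm_apply (hasDerivAt_const r v)).clm_apply (hasDerivAt_const r w)
    simpa [familyDeriv] using h1.deriv.symm

end SmoothFamily

/-! ### Borel's lemma for tensor fields, and forms in block shape -/

section Charts

variable {E : Type*} [NormedAddCommGroup E] [NormedSpace ℝ E]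
  {H : Type*} [TopologicalSpace H] [ChartedSpace E H]

theorem contDiffAt_comp_extChartAt_symm [IsManifold 𝓘(ℝ, E) ∞ H] {W : Type*}
    [NormedAddCommGroup W] [NormedSpace ℝ W] {f : H → W} {p₀ : H} {z : E}
    (hz : z ∈ (extChartAt 𝓘(ℝ, E) p₀).target)
    (hf : ContMDiffAt 𝓘(ℝ, E) 𝓘(ℝ, W) ∞ f ((extChartAt 𝓘(ℝ, E) p₀).symm z)) :
    ContDiffAt ℝ ∞ (fun z ↦ f ((extChartAt 𝓘(ℝ, E) p₀).symm z)) z := by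
  have h := (contMDiffOn_extChartAt_symm (I := 𝓘(ℝ, E)) (n := ∞) p₀).contMDiffAt
    ((isOpen_extChartAt_target p₀).mem_nhds hz)
  exact (hf.comp z h).contDiffAt

/-- A second countable manifold is covered by countably many charts, with cut-off functions
supported in the images of the charts and equal to `1` near some chart image of every point. -/
theorem exists_countable_chart_cutoff [FiniteDimensional ℝ E] [SecondCountableTopology H]
    [Nonempty H] :
    ∃ (q : ℕ → H) (ρ : ℕ → E → ℝ), (∀ j, ContDiff ℝ ∞ (ρ j)) ∧ (∀ j, HasCompactSupport (ρ j)) ∧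
      (∀ j, tsupport (ρ j) ⊆ (extChartAt 𝓘(ℝ, E) (q j)).target) ∧
      ∀ p, ∃ j, p ∈ (chartAt E (q j)).source ∧
        ∀ᶠ z in 𝓝 (extChartAt 𝓘(ℝ, E) (q j) p), ρ j z = 1 := by
  have hb : ∀ p : H, ∃ f : ContDiffBump (extChartAt 𝓘(ℝ, E) p p),
      Metric.closedBall (extChartAt 𝓘(ℝ, E) p p) f.rOut ⊆ (extChartAt 𝓘(ℝ, E) p).target := by
    intro p
    obtain ⟨ε, hε, h⟩ := Metric.nhds_basis_closedBall.mem_iff.1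
      (extChartAt_target_mem_nhds (I := 𝓘(ℝ, E)) p)
    exact ⟨⟨ε / 2, ε, half_pos hε, half_lt_self hε⟩, h⟩
  choose f hf using hb
  let N : H → Set H := fun p ↦ (chartAt E p).source ∩
    extChartAt 𝓘(ℝ, E) p ⁻¹' Metric.ball (extChartAt 𝓘(ℝ, E) p p) (f p).rIn
  have hN : ∀ p, N p ∈ 𝓝 p := fun p ↦ inter_mem (chart_source_mem_nhds E p)
    ((continuousAt_extChartAt p).preimage_mem_nhds (Metric.ball_mem_nhds _ (f p).rIn_pos))
  obtain ⟨s, hs, hsN⟩ := TopologicalSpace.countable_cover_nhds hN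
  have hne : s.Nonempty := by
    obtain ⟨p⟩ := ‹Nonempty H›
    have : p ∈ ⋃ x ∈ s, N x := hsN ▸ Set.mem_univ p
    obtain ⟨x, hx, -⟩ := Set.mem_iUnion₂.1 this
    exact ⟨x, hx⟩
  obtain ⟨q, rfl⟩ := hs.exists_eq_range hne
  refine ⟨q, fun j ↦ f (q j), fun j ↦ (f (q j)).contDiff, fun j ↦ (f (q j)).hasCompactSupport,
    fun j ↦ (f (q j)).tsupport_eq.trans_subset (hf (q j)), fun p ↦ ?_⟩
  have : p ∈ ⋃ x ∈ Set.range q, N x := hsN ▸ Set.mem_univ p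
  obtain ⟨x, ⟨j, rfl⟩, hx⟩ := Set.mem_iUnion₂.1 this
  exact ⟨j, hx.1, (f (q j)).eventuallyEq_one_of_mem_ball hx.2⟩

end Charts

section BorelFamily

variable {E : Type*} [NormedAddCommGroup E] [NormedSpace ℝ E]
  {H : Type*} [TopologicalSpace H] [ChartedSpace E H] [IsManifold 𝓘(ℝ, E) ∞ H]

theorem contDiffAt_pullBilin_coordFrame {T : Tensor02 E H} (hT : T.IsSmooth) {p₀ : H} {z : E}
    (hz : z ∈ (extChartAt 𝓘(ℝ, E) p₀).target) :
    ContDiffAt ℝ ∞ (fun z ↦ pullBilin (coordFrame p₀ ((extChartAt 𝓘(ℝ, E) p₀).symm z))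
      (T ((extChartAt 𝓘(ℝ, E) p₀).symm z) : E →L[ℝ] E →L[ℝ] ℝ)) z := by
  have hs : (extChartAt 𝓘(ℝ, E) p₀).symm z ∈ (chartAt E p₀).source := by
    simpa using (extChartAt 𝓘(ℝ, E) p₀).map_target hz
  exact contDiffAt_comp_extChartAt_symm (W := E →L[ℝ] E →L[ℝ] ℝ)
    (f := fun y ↦ pullBilin (coordFrame p₀ y) (T y : E →L[ℝ] E →L[ℝ] ℝ)) hz
    ((T.contMDiffAt_iff_coord hs).1 (hT _))

set_option synthInstance.maxHeartbeats 200000 in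
/-- **Borel's lemma for tensor fields.** Every sequence of smooth `(0,2)`-tensor fields is the
sequence of derivatives at `r = 0` of a smooth one-parameter family of tensor fields. -/
theorem exists_family_iteratedDeriv_eq [FiniteDimensional ℝ E] [SecondCountableTopology H]
    [Nonempty H] (T : ℕ → Tensor02 E H) (hT : ∀ k, (T k).IsSmooth) :
    ∃ S : ℝ → H → E →L[ℝ] E →L[ℝ] ℝ,
      (∀ p, ∃ p₀, p ∈ (chartAt E p₀).source ∧ ∀ r, ContDiffAt ℝ ∞
        (fun z : ℝ × E ↦ pullBilin (coordFrame p₀ ((extChartAt 𝓘(ℝ, E) p₀).symm z.2))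
          (S z.1 ((extChartAt 𝓘(ℝ, E) p₀).symm z.2))) (r, extChartAt 𝓘(ℝ, E) p₀ p)) ∧
      (∀ n p (v w : E), iteratedDeriv n (fun r ↦ S r p v w) 0 = T n p v w) ∧
      ((∀ k, (T k).IsSymm) → ∀ r p v w, S r p v w = S r p w v) := by
  obtain ⟨q, ρ, hρ, hρc, hρs, hcov⟩ := exists_countable_chart_cutoff (E := E) (H := H)
  let T' : ℕ → H → E →L[ℝ] E →L[ℝ] ℝ := T
  let G : ℕ → ℕ → E → E →L[ℝ] E →L[ℝ] ℝ := fun j k z ↦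
    pullBilin (coordFrame (q j) ((extChartAt 𝓘(ℝ, E) (q j)).symm z))
      (T' k ((extChartAt 𝓘(ℝ, E) (q j)).symm z))
  let F : ℕ → ℕ → E → E →L[ℝ] E →L[ℝ] ℝ := fun j k z ↦ ρ j z • G j k z
  have hF : ∀ j k, ContDiff ℝ ∞ (F j k) := by
    intro j k
    rw [contDiff_iff_contDiffAt]
    intro z
    by_cases hz : z ∈ tsupport (ρ j)
    · exact (hρ j).contDiffAt.smul (contDiffAt_pullBilin_coordFrame (hT k) (hρs j hz))
    · refine (contDiffAt_const (c := 0)).congr_of_eventuallyEq ?_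
      filter_upwards [notMem_tsupport_iff_eventuallyEq.1 hz] with y hy
      change ρ j y • G j k y = 0
      rw [hy, Pi.zero_apply, zero_smul]
  obtain ⟨c, hc, hcw⟩ := exists_borel_coefficients F hF fun j k ↦ (hρc j).smul_right
  -- the tensors at `p` are dominated by their components in a chart
  have hdom : ∀ p, ∃ j A, 0 ≤ A ∧ ∀ k, ‖T' k p‖ ≤ A * ‖F j k (extChartAt 𝓘(ℝ, E) (q j) p)‖ := by
    intro p
    obtain ⟨j, hp, hj⟩ := hcov p
    obtain ⟨e, he⟩ := exists_equiv_coordFrame hp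
    refine ⟨j, ‖pullBilin (e.symm : E →L[ℝ] E)‖, norm_nonneg _, fun k ↦ ?_⟩
    have hp' : p ∈ (extChartAt 𝓘(ℝ, E) (q j)).source := by simpa using hp
    have : T' k p =
        pullBilin (e.symm : E →L[ℝ] E) (F j k (extChartAt 𝓘(ℝ, E) (q j) p)) := by
      refine ContinuousLinearMap.ext fun v ↦ ContinuousLinearMap.ext fun w ↦ ?_
      simp only [F, G, hj.self_of_nhds, one_smul, (extChartAt 𝓘(ℝ, E) (q j)).left_inv hp', ← he,
        pullBilin_apply]
      simp
    rw [this]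
    exact (pullBilin (e.symm : E →L[ℝ] E)).le_opNorm _
  have hsum : ∀ r p, Summable fun k ↦ c k r • T' k p := by
    intro r p
    obtain ⟨j, A, -, hA⟩ := hdom p
    have := (hcw (fun k ↦ ‖T' k p‖) j (extChartAt 𝓘(ℝ, E) (q j) p) A
      (fun k ↦ by rw [abs_norm]; exact hA k)).1 r
    refine Summable.of_norm ?_
    simpa [norm_smul, abs_mul] using this.abs
  have happ : ∀ r p v w, (∑' k, c k r • T' k p) v w = ∑' k, c k r * T' k p v w := by
    intro r p v w
    let L : (E →L[ℝ] E →L[ℝ] ℝ) →L[ℝ] ℝ :=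
      (ContinuousLinearMap.apply ℝ ℝ w).comp (ContinuousLinearMap.apply ℝ (E →L[ℝ] ℝ) v)
    have := L.map_tsum (hsum r p)
    simpa [L] using this
  refine ⟨fun r p ↦ ∑' k, c k r • T' k p, fun p ↦ ?_, fun n p v w ↦ ?_, fun hs r p v w ↦ ?_⟩
  · obtain ⟨j, hp, hj⟩ := hcov p
    refine ⟨q j, hp, fun r ↦ (hc j).contDiffAt.congr_of_eventuallyEq ?_⟩
    have ht : Tendsto (fun z : ℝ × E ↦ z.2) (𝓝 (r, extChartAt 𝓘(ℝ, E) (q j) p))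
        (𝓝 (extChartAt 𝓘(ℝ, E) (q j) p)) := continuous_snd.tendsto (r, extChartAt 𝓘(ℝ, E) (q j) p)
    filter_upwards [ht.eventually hj] with z hz
    rw [ContinuousLinearMap.map_tsum _ (hsum _ _)]
    refine tsum_congr fun k ↦ ?_
    simp [F, G, hz]
  · obtain ⟨j, A, hA0, hA⟩ := hdom p
    simp only [happ]
    refine (hcw (fun k ↦ T' k p v w) j (extChartAt 𝓘(ℝ, E) (q j) p) (A * (‖v‖ * ‖w‖))
      fun k ↦ ?_).2 n
    calc |T' k p v w| ≤ ‖T' k p‖ * ‖v‖ * ‖w‖ := (T' k p).le_opNorm₂ v w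
      _ ≤ (A * ‖F j k (extChartAt 𝓘(ℝ, E) (q j) p)‖) * ‖v‖ * ‖w‖ := by gcongr; exact hA k
      _ = _ := by ring
  · rw [happ, happ]
    exact tsum_congr fun k ↦ congrArg _ (hs k p v w)

end BorelFamily

section BlockForm

variable {E : Type*} [NormedAddCommGroup E] [NormedSpace ℝ E]

/-- The bilinear form on `ℝ × E` with the blocks `a`, `η` and `s`. -/
noncomputable def blockForm (a : ℝ) (η : E →L[ℝ] ℝ) (s : E →L[ℝ] E →L[ℝ] ℝ) :
    (ℝ × E) →L[ℝ] (ℝ × E) →L[ℝ] ℝ :=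
  (ContinuousLinearMap.fst ℝ ℝ E).smulRight
      (a • ContinuousLinearMap.fst ℝ ℝ E + η.comp (ContinuousLinearMap.snd ℝ ℝ E)) +
    (η.comp (ContinuousLinearMap.snd ℝ ℝ E)).smulRight (ContinuousLinearMap.fst ℝ ℝ E) +
    pullBilin (ContinuousLinearMap.snd ℝ ℝ E) s

theorem blockForm_apply (a : ℝ) (η : E →L[ℝ] ℝ) (s : E →L[ℝ] E →L[ℝ] ℝ) (v w : ℝ × E) :
    blockForm a η s v w = v.1 * (a * w.1 + η w.2) + η v.2 * w.1 + s v.2 w.2 := by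
  simp [blockForm]
  ring

theorem blockForm_apply_one_zero (a : ℝ) (η : E →L[ℝ] ℝ) (s : E →L[ℝ] E →L[ℝ] ℝ) (w : ℝ × E) :
    blockForm a η s (1, 0) w = a * w.1 + η w.2 := by
  simp [blockForm_apply]

theorem blockForm_apply_zero_zero (a : ℝ) (η : E →L[ℝ] ℝ) (s : E →L[ℝ] E →L[ℝ] ℝ) (v w : E) :
    blockForm a η s (0, v) (0, w) = s v w := by
  simp [blockForm_apply]

theorem blockForm_apply_one_zero_one_zero (a : ℝ) (η : E →L[ℝ] ℝ) (s : E →L[ℝ] E →L[ℝ] ℝ) :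
    blockForm a η s (1, 0) (1, 0) = a := by
  simp [blockForm_apply]

theorem blockForm_symm {a : ℝ} {η : E →L[ℝ] ℝ} {s : E →L[ℝ] E →L[ℝ] ℝ}
    (hs : ∀ v w, s v w = s w v) (v w : ℝ × E) : blockForm a η s v w = blockForm a η s w v := by
  rw [blockForm_apply, blockForm_apply, hs]
  ring

theorem pullBilin_blockForm (f : E →L[ℝ] E) (a : ℝ) (η : E →L[ℝ] ℝ) (s : E →L[ℝ] E →L[ℝ] ℝ) :
    pullBilin ((ContinuousLinearMap.id ℝ ℝ).prodMap f) (blockForm a η s) =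
      blockForm a (η.comp f) (pullBilin f s) := by
  refine ContinuousLinearMap.ext fun v ↦ ContinuousLinearMap.ext fun w ↦ ?_
  simp [blockForm_apply]

theorem ContDiffAt.blockForm {F : Type*} [NormedAddCommGroup F] [NormedSpace ℝ F] {z : F}
    {a : F → ℝ} {η : F → E →L[ℝ] ℝ} {s : F → E →L[ℝ] E →L[ℝ] ℝ} (ha : ContDiffAt ℝ ∞ a z)
    (hη : ContDiffAt ℝ ∞ η z) (hs : ContDiffAt ℝ ∞ s z) :
    ContDiffAt ℝ ∞ (fun z ↦ blockForm (a z) (η z) (s z)) z := by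
  have h1 : ContDiffAt ℝ ∞ (fun z ↦ (η z).comp (ContinuousLinearMap.snd ℝ ℝ E)) z :=
    hη.clm_comp contDiffAt_const
  have h2 : ContDiffAt ℝ ∞ (fun z ↦ pullBilin (ContinuousLinearMap.snd ℝ ℝ E) (s z)) z :=
    (pullBilin (ContinuousLinearMap.snd ℝ ℝ E)).contDiff.contDiffAt.comp z hs
  exact ((contDiffAt_const.smulRight ((ha.smul contDiffAt_const).add h1)).add
    (h1.smulRight contDiffAt_const)).add h2

end BlockForm

/-! ### The ambient metric -/

section NondegenerateFamily

variable {E : Type*} [NormedAddCommGroup E] [NormedSpace ℝ E]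
  {H : Type*} [TopologicalSpace H] [ChartedSpace E H] [IsManifold 𝓘(ℝ, E) ∞ H]
  {B : ℝ → H → (ℝ × E) →L[ℝ] (ℝ × E) →L[ℝ] ℝ}

theorem pullBilin_nondegenerate_iff {V V' : Type*} [NormedAddCommGroup V] [NormedSpace ℝ V]
    [NormedAddCommGroup V'] [NormedSpace ℝ V'] (e : V ≃L[ℝ] V') (b : V' →L[ℝ] V' →L[ℝ] ℝ) :
    (∀ v, (∀ w, pullBilin (e : V →L[ℝ] V') b v w = 0) → v = 0) ↔
      ∀ v, (∀ w, b v w = 0) → v = 0 := by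
  constructor
  · intro h v hv
    have := h (e.symm v) fun w ↦ by simpa using hv (e w)
    simpa using this
  · intro h v hv
    have := h (e v) fun w ↦ by simpa using hv (e.symm w)
    simpa using this

/-- The components of a smooth family in a chart depend continuously on the point, and determine the
family up to a linear change of coordinates. -/
theorem SmoothFamily.exists_local_components (hB : SmoothFamily B) (x : ℝ × H) :
    ∃ b : ℝ × H → (ℝ × E) →L[ℝ] (ℝ × E) →L[ℝ] ℝ, ContinuousAt b x ∧
      ∀ᶠ y in 𝓝 x, ∃ e : (ℝ × E) ≃L[ℝ] (ℝ × E),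
        b y = pullBilin (e : (ℝ × E) →L[ℝ] (ℝ × E)) (B y.1 y.2) := by
  obtain ⟨p₀, hp, h⟩ := hB x.2
  have hc : ContinuousAt (fun y : ℝ × H ↦ (y.1, extChartAt 𝓘(ℝ, E) p₀ y.2)) x :=
    continuousAt_fst.prodMk
      ((continuousAt_extChartAt' (I := 𝓘(ℝ, E)) (by simpa using hp)).comp continuousAt_snd)
  refine ⟨fun y ↦ familyCoord B p₀ (y.1, extChartAt 𝓘(ℝ, E) p₀ y.2),
    ContinuousAt.comp (g := familyCoord B p₀) (h x.1).continuousAt hc, ?_⟩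
  have hs := continuousAt_snd.preimage_mem_nhds ((chartAt E p₀).open_source.mem_nhds hp)
  filter_upwards [hs] with y hy
  obtain ⟨e, he⟩ := exists_equiv_cylFrame (E := E) hy
  have hy' : y.2 ∈ (extChartAt 𝓘(ℝ, E) p₀).source := by simpa using hy
  refine ⟨e, ?_⟩
  simp only [familyCoord, cylBilin, (extChartAt 𝓘(ℝ, E) p₀).left_inv hy', he]

variable [FiniteDimensional ℝ E]

theorem SmoothFamily.isOpen_nondegenerate (hB : SmoothFamily B) :
    IsOpen {x : ℝ × H | ∀ v, (∀ w, B x.1 x.2 v w = 0) → v = 0} := by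
  rw [isOpen_iff_mem_nhds]
  intro x hx
  obtain ⟨b, hb, he⟩ := hB.exists_local_components x
  have hbx : ∀ v, (∀ w, b x v w = 0) → v = 0 := by
    obtain ⟨e, he⟩ := he.self_of_nhds
    rw [he]
    exact (pullBilin_nondegenerate_iff e _).2 hx
  filter_upwards [he, hb.preimage_mem_nhds (isOpen_setOf_nondegenerate.mem_nhds hbx)] with y hy hby
  obtain ⟨e, hy⟩ := hy
  have h2 : ∀ v, (∀ w, b y v w = 0) → v = 0 := hby
  rw [hy] at h2
  exact (pullBilin_nondegenerate_iff e _).1 h2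

theorem sig_pullBilin {V V' : Type*} [NormedAddCommGroup V] [NormedSpace ℝ V]
    [NormedAddCommGroup V'] [NormedSpace ℝ V'] (e : V ≃L[ℝ] V') (b : V' →L[ℝ] V' →L[ℝ] ℝ) :
    sigPos (bilinQuadForm (pullBilin (e : V →L[ℝ] V') b)) = sigPos (bilinQuadForm b) ∧
    sigNeg (bilinQuadForm (pullBilin (e : V →L[ℝ] V') b)) = sigNeg (bilinQuadForm b) :=
  sig_bilinearComp b e

theorem SmoothFamily.eventually_sig_eq (hB : SmoothFamily B)
    (hs : ∀ r p v w, B r p v w = B r p w v) {x : ℝ × H}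
    (hx : ∀ v, (∀ w, B x.1 x.2 v w = 0) → v = 0) :
    ∀ᶠ y in 𝓝 x, sigPos (bilinQuadForm (B y.1 y.2)) = sigPos (bilinQuadForm (B x.1 x.2)) ∧
      sigNeg (bilinQuadForm (B y.1 y.2)) = sigNeg (bilinQuadForm (B x.1 x.2)) := by
  obtain ⟨b, hb, he⟩ := hB.exists_local_components x
  obtain ⟨e, hex⟩ := he.self_of_nhds
  have hbs : ∀ v w, b x v w = b x w v := fun v w ↦ by
    rw [hex, pullBilin_apply, pullBilin_apply, hs]
  have hbx : ∀ v, (∀ w, b x v w = 0) → v = 0 := by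
    rw [hex]
    exact (pullBilin_nondegenerate_iff e _).2 hx
  filter_upwards [he, hb.eventually (_root_.eventually_sig_eq hbs hbx),
    hB.isOpen_nondegenerate.mem_nhds hx] with y hy hby hny
  obtain ⟨f, hy⟩ := hy
  have h := hby (fun v w ↦ by rw [hy, pullBilin_apply, pullBilin_apply, hs])
    (by rw [hy]; exact (pullBilin_nondegenerate_iff f _).2 hny)
  rwa [hy, hex, (sig_pullBilin f _).1, (sig_pullBilin f _).2, (sig_pullBilin e _).1,
    (sig_pullBilin e _).2] at h

/-- A family that is non-degenerate at `r = 0` is so on a connected open neighbourhood of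
`{0} × H`: the component of the zero section in the open set where the family is
non-degenerate. -/
theorem SmoothFamily.exists_opens (hB : SmoothFamily B) [ConnectedSpace H]
    (h0 : ∀ p v, (∀ w, B 0 p v w = 0) → v = 0) :
    ∃ U : TopologicalSpace.Opens (Cylinder H),
      (∀ p : H, ((0, p) : ℝ × H) ∈ (U : Set (Cylinder H))) ∧ ConnectedSpace U ∧
      ∀ x : U, ∀ v, (∀ w, B x.1.1 x.1.2 v w = 0) → v = 0 := by
  let N : Set (Cylinder H) := {x : ℝ × H | ∀ v, (∀ w, B x.1 x.2 v w = 0) → v = 0}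
  have hN : IsOpen N := hB.isOpen_nondegenerate
  have hlc : LocallyConnectedSpace (Cylinder H) :=
    ChartedSpace.locallyConnectedSpace (ℝ × E) (Cylinder H)
  obtain ⟨p⟩ := (inferInstance : Nonempty H)
  let x : Cylinder H := ((0, p) : ℝ × H)
  let i : H → Cylinder H := fun p ↦ ((0, p) : ℝ × H)
  have hi : Continuous i := Continuous.prodMk_right (X := ℝ) (Y := H) 0
  have hr : Set.range i ⊆ N := by
    rintro _ ⟨p, rfl⟩
    exact h0 p
  refine ⟨⟨connectedComponentIn N x, hN.connectedComponentIn⟩, fun p' ↦ ?_, ?_, fun y ↦ ?_⟩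
  · exact (isPreconnected_range hi).subset_connectedComponentIn ⟨p, rfl⟩ hr ⟨p', rfl⟩
  · exact isConnected_iff_connectedSpace.1 (isConnected_connectedComponentIn_iff.2 (h0 p))
  · exact connectedComponentIn_subset N x y.2

/-- On a connected open set where the family is non-degenerate it has constant signature, since the
signature is locally constant. -/
theorem SmoothFamily.isSemiRiemannianMetric (hB : SmoothFamily B)
    (hs : ∀ r p v w, B r p v w = B r p w v) {U : TopologicalSpace.Opens (Cylinder H)}
    [ConnectedSpace U] (hU : ∀ p : H, ((0, p) : ℝ × H) ∈ (U : Set (Cylinder H)))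
    (hn : ∀ x : U, ∀ v, (∀ w, B x.1.1 x.1.2 v w = 0) → v = 0) (p : H) :
    IsSemiRiemannianMetric (familyTensor U B) (sigPos (bilinQuadForm (B 0 p)))
      (sigNeg (bilinQuadForm (B 0 p))) := by
  let x₀ : U := Cylinder.zeroSection hU p
  have hev : ∀ x : U, ∀ᶠ y : U in 𝓝 x,
      sigPos (bilinQuadForm (B y.1.1 y.1.2)) = sigPos (bilinQuadForm (B x.1.1 x.1.2)) ∧
      sigNeg (bilinQuadForm (B y.1.1 y.1.2)) = sigNeg (bilinQuadForm (B x.1.1 x.1.2)) := fun x ↦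
    continuousAt_subtype_val.eventually (hB.eventually_sig_eq hs (hn x))
  have h1 : IsLocallyConstant fun x : U ↦ sigPos (bilinQuadForm (B x.1.1 x.1.2)) :=
    (IsLocallyConstant.iff_eventually_eq _).2 fun x ↦ (hev x).mono fun y hy ↦ hy.1
  have h2 : IsLocallyConstant fun x : U ↦ sigNeg (bilinQuadForm (B x.1.1 x.1.2)) :=
    (IsLocallyConstant.iff_eventually_eq _).2 fun x ↦ (hev x).mono fun y hy ↦ hy.2
  exact
    { smooth := hB.familyTensor_isSmooth hU
      symm := fun x v w ↦ hs _ _ v w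
      nondegenerate := fun x v hv ↦ hn x v hv
      sigPos_eq := fun x ↦ h1.apply_eq_of_preconnectedSpace x x₀
      sigNeg_eq := fun x ↦ h2.apply_eq_of_preconnectedSpace x x₀ }

end NondegenerateFamily

section Ambient

variable {E : Type*} [NormedAddCommGroup E] [NormedSpace ℝ E]
  {H : Type*} [TopologicalSpace H] [ChartedSpace E H] [IsManifold 𝓘(ℝ, E) ∞ H]

/-- The components of `df` are the partial derivatives of `f` in the chart, hence smooth. -/
theorem contDiffAt_mvfderiv_comp_coordFrame {f : H → ℝ} (hf : ContMDiff 𝓘(ℝ, E) 𝓘(ℝ) ∞ f) {p₀ : H}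
    {z : E} (hz : z ∈ (extChartAt 𝓘(ℝ, E) p₀).target) :
    ContDiffAt ℝ ∞ (fun z ↦ (mvfderiv 𝓘(ℝ, E) f ((extChartAt 𝓘(ℝ, E) p₀).symm z) : E →L[ℝ] ℝ).comp
      (coordFrame p₀ ((extChartAt 𝓘(ℝ, E) p₀).symm z))) z := by
  have h1 : ContDiffAt ℝ ∞ (fun z ↦ f ((extChartAt 𝓘(ℝ, E) p₀).symm z)) z :=
    contDiffAt_comp_extChartAt_symm hz (hf _)
  refine (h1.fderiv_right (m := ∞) (by simp)).congr_of_eventuallyEq ?_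
  filter_upwards [(isOpen_extChartAt_target p₀).mem_nhds hz] with y hy
  have hs : (extChartAt 𝓘(ℝ, E) p₀).symm y ∈ (chartAt E p₀).source := by
    simpa using (extChartAt 𝓘(ℝ, E) p₀).map_target hy
  have h2 := TangentBundle.symmL_trivializationAt (I := 𝓘(ℝ, E)) hs
  rw [(extChartAt 𝓘(ℝ, E) p₀).right_inv hy, modelWithCornersSelf_coe, Set.range_id,
    mfderivWithin_univ] at h2
  have h3 : MDifferentiableAt 𝓘(ℝ, E) 𝓘(ℝ, E) (extChartAt 𝓘(ℝ, E) p₀).symm y :=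
    ((contMDiffOn_extChartAt_symm (I := 𝓘(ℝ, E)) (n := ∞) p₀).contMDiffAt
      ((isOpen_extChartAt_target p₀).mem_nhds hy)).mdifferentiableAt (by simp)
  have h4 := ((hf _).mdifferentiableAt (by simp)).hasMFDerivAt.comp y h3.hasMFDerivAt
  let L₁ : E →L[ℝ] ℝ := mvfderiv 𝓘(ℝ, E) f ((extChartAt 𝓘(ℝ, E) p₀).symm y)
  let L₂ : E →L[ℝ] E := mfderiv 𝓘(ℝ, E) 𝓘(ℝ, E) (extChartAt 𝓘(ℝ, E) p₀).symm y
  have h5 : HasFDerivAt (fun z ↦ f ((extChartAt 𝓘(ℝ, E) p₀).symm z)) (L₁.comp L₂) y :=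
    hasMFDerivAt_iff_hasFDerivAt.1 h4
  have h6 : coordFrame p₀ ((extChartAt 𝓘(ℝ, E) p₀).symm y) = L₂ := h2
  exact (congrArg L₁.comp h6).trans h5.fderiv.symm

/-- The components, in the direct sum decomposition of `T(ℝ × H)`, of a metric whose rigging
`ξ = ∂_r` is geodesic: `g(ξ, ξ) = a` does not depend on `r`, and `g(ξ, ·) = ℓ + (r / 2) da` on
`TH`. -/
noncomputable def riggedFamily (a : H → ℝ) (ℓ : OneForm E H) (S : ℝ → H → E →L[ℝ] E →L[ℝ] ℝ)
    (r : ℝ) (p : H) : (ℝ × E) →L[ℝ] (ℝ × E) →L[ℝ] ℝ :=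
  blockForm (a p) ((ℓ p : E →L[ℝ] ℝ) + (r / 2) • (mvfderiv 𝓘(ℝ, E) a p : E →L[ℝ] ℝ)) (S r p)

variable {a : H → ℝ} {ℓ : OneForm E H} {S : ℝ → H → E →L[ℝ] E →L[ℝ] ℝ}

omit [IsManifold 𝓘(ℝ, E) ∞ H] in
theorem riggedFamily_apply_one_zero (r : ℝ) (p : H) (w : ℝ × E) :
    riggedFamily a ℓ S r p (1, 0) w =
      a p * w.1 + (ℓ p w.2 + r / 2 * mvfderiv 𝓘(ℝ, E) a p w.2) :=
  blockForm_apply_one_zero _ _ _ w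

omit [IsManifold 𝓘(ℝ, E) ∞ H] in
theorem riggedFamily_apply_zero_zero (r : ℝ) (p : H) (v w : E) :
    riggedFamily a ℓ S r p (0, v) (0, w) = S r p v w :=
  blockForm_apply_zero_zero _ _ _ v w

theorem smoothFamily_riggedFamily (ha : ContMDiff 𝓘(ℝ, E) 𝓘(ℝ) ∞ a) (hℓ : ℓ.IsSmooth)
    (hS : ∀ p, ∃ p₀, p ∈ (chartAt E p₀).source ∧ ∀ r, ContDiffAt ℝ ∞
      (fun z : ℝ × E ↦ pullBilin (coordFrame p₀ ((extChartAt 𝓘(ℝ, E) p₀).symm z.2))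
        (S z.1 ((extChartAt 𝓘(ℝ, E) p₀).symm z.2))) (r, extChartAt 𝓘(ℝ, E) p₀ p)) :
    SmoothFamily (riggedFamily a ℓ S) := by
  intro p
  obtain ⟨p₀, hp, h⟩ := hS p
  refine ⟨p₀, hp, fun r ↦ ?_⟩
  have hp' : p ∈ (extChartAt 𝓘(ℝ, E) p₀).source := by simpa using hp
  have hz := (extChartAt 𝓘(ℝ, E) p₀).map_source hp'
  have h1 : ContDiffAt ℝ ∞ (fun z : ℝ × E ↦ a ((extChartAt 𝓘(ℝ, E) p₀).symm z.2))
      (r, extChartAt 𝓘(ℝ, E) p₀ p) :=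
    ContDiffAt.comp (g := fun z ↦ a ((extChartAt 𝓘(ℝ, E) p₀).symm z)) _
      (contDiffAt_comp_extChartAt_symm hz (ha _)) contDiffAt_snd
  have h2 : ContDiffAt ℝ ∞ (fun z : ℝ × E ↦ (ℓ ((extChartAt 𝓘(ℝ, E) p₀).symm z.2) : E →L[ℝ] ℝ).comp
      (coordFrame p₀ ((extChartAt 𝓘(ℝ, E) p₀).symm z.2))) (r, extChartAt 𝓘(ℝ, E) p₀ p) :=
    ContDiffAt.comp (g := fun z ↦ (ℓ ((extChartAt 𝓘(ℝ, E) p₀).symm z) : E →L[ℝ] ℝ).comp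
      (coordFrame p₀ ((extChartAt 𝓘(ℝ, E) p₀).symm z))) _
      (contDiffAt_comp_extChartAt_symm (f := fun y ↦ (ℓ y : E →L[ℝ] ℝ).comp (coordFrame p₀ y)) hz
        ((ℓ.contMDiffAt_iff_coord
          (by rwa [(extChartAt 𝓘(ℝ, E) p₀).left_inv hp'])).1 (hℓ _))) contDiffAt_snd
  have h3 : ContDiffAt ℝ ∞ (fun z : ℝ × E ↦
      (mvfderiv 𝓘(ℝ, E) a ((extChartAt 𝓘(ℝ, E) p₀).symm z.2) : E →L[ℝ] ℝ).comp
      (coordFrame p₀ ((extChartAt 𝓘(ℝ, E) p₀).symm z.2))) (r, extChartAt 𝓘(ℝ, E) p₀ p) :=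
    ContDiffAt.comp (g := fun z ↦ (mvfderiv 𝓘(ℝ, E) a ((extChartAt 𝓘(ℝ, E) p₀).symm z) :
      E →L[ℝ] ℝ).comp (coordFrame p₀ ((extChartAt 𝓘(ℝ, E) p₀).symm z))) _
      (contDiffAt_mvfderiv_comp_coordFrame ha hz) contDiffAt_snd
  have h4 : ContDiffAt ℝ ∞ (fun z : ℝ × E ↦ z.1 / 2) (r, extChartAt 𝓘(ℝ, E) p₀ p) :=
    contDiffAt_fst.div_const 2
  refine (ContDiffAt.blockForm h1 (h2.add (h4.smul h3)) (h r)).congr_of_eventuallyEq ?_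
  refine Eventually.of_forall fun z ↦ ?_
  exact pullBilin_blockForm _ _ _ _

/-- Since `∂_r g(∂_r, ∂_r) = 0` and `∂_r g(∂_r, w) = ½ da(w)`, one has
`(𝓛_ξ g)(ξ, ·) = ½ d(g(ξ, ξ))` for `ξ = ∂_r`, which is the geodesic equation for `ξ`. -/
theorem familyTensor_riggedFamily_isGeodesicField [FiniteDimensional ℝ E]
    {U : TopologicalSpace.Opens (Cylinder H)}
    (hU : ∀ p : H, ((0, p) : ℝ × H) ∈ (U : Set (Cylinder H)))
    (ha : ContMDiff 𝓘(ℝ, E) 𝓘(ℝ) ∞ a) (hB : SmoothFamily (riggedFamily a ℓ S)) {m n : ℕ}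
    (hg : IsSemiRiemannianMetric (familyTensor U (riggedFamily a ℓ S)) m n) :
    IsGeodesicField (familyTensor U (riggedFamily a ℓ S)) (radialField E U) := by
  refine isGeodesicField_of_lieDeriv hg.smooth hg.symm hg.nondegenerate radialField_isSmooth
    fun x (w : ℝ × E) ↦ ?_
  have h1 : (familyTensor U (riggedFamily a ℓ S)).eval (radialField E U) (radialField E U) =
      a ∘ fun y : U ↦ y.1.2 := by
    funext y
    exact blockForm_apply_one_zero_one_zero _ _ _
  have h2 := ((ha x.1.2).mdifferentiableAt (by simp)).hasMFDerivAt.comp x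
    (Cylinder.hasMFDerivAt_snd (E := E) x)
  have h3 : mvfderiv 𝓘(ℝ, ℝ × E) (a ∘ fun y : U ↦ y.1.2) x w =
      mvfderiv 𝓘(ℝ, E) a x.1.2 w.2 := congr($(h2.mfderiv) w)
  rw [h1, h3, lieDeriv_familyTensor hB hU]
  have h4 := familyDeriv_iterate_apply hB 1 x.1.1 x.1.2 ((1, 0) : ℝ × E) w
  rw [iteratedDeriv_one] at h4
  refine h4.trans ?_
  have h5 : HasDerivAt (fun r ↦ riggedFamily a ℓ S r x.1.2 ((1, 0) : ℝ × E) w)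
      (1 / 2 * mvfderiv 𝓘(ℝ, E) a x.1.2 w.2) x.1.1 := by
    simp only [riggedFamily_apply_one_zero]
    exact ((((hasDerivAt_id x.1.1).div_const 2).mul_const _).const_add _).const_add _
  exact h5.deriv

/-- The tensor fields that the derivatives of the metric in the transverse direction have to be
equal to along the hypersurface: `γ` in order `0` and `2 Y_k` in order `k ≥ 1`. -/
noncomputable def transverseJet (γ : Tensor02 E H) (Y : ℕ → Tensor02 E H) : ℕ → Tensor02 E H
  | 0 => γ
  | k + 1 => fun p ↦ ((2 : ℝ) • (Y (k + 1) p : E →L[ℝ] E →L[ℝ] ℝ) : E →L[ℝ] E →L[ℝ] ℝ)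

set_option synthInstance.maxHeartbeats 200000 in
theorem transverseJet_isSmooth {γ : Tensor02 E H} {Y : ℕ → Tensor02 E H} (hγ : γ.IsSmooth)
    (hY : ∀ k, (Y (k + 1)).IsSmooth) (k : ℕ) : (transverseJet γ Y k).IsSmooth := by
  cases k with
  | zero => exact hγ
  | succ k =>
    intro x
    rw [Tensor02.contMDiffAt_iff_coord _ (mem_chart_source E x)]
    have h := (Tensor02.contMDiffAt_iff_coord _ (mem_chart_source E x)).1 (hY k x)
    have h2 : ContMDiff 𝓘(ℝ, E →L[ℝ] E →L[ℝ] ℝ) 𝓘(ℝ, E →L[ℝ] E →L[ℝ] ℝ) ∞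
        fun b : E →L[ℝ] E →L[ℝ] ℝ ↦ (2 : ℝ) • b := (contDiff_const_smul 2).contMDiff
    exact h2.contMDiffAt.comp x h

omit [IsManifold 𝓘(ℝ, E) ∞ H] in
theorem transverseJet_isSymm {γ : Tensor02 E H} {Y : ℕ → Tensor02 E H} (hγ : γ.IsSymm)
    (hY : ∀ k, (Y (k + 1)).IsSymm) (k : ℕ) : (transverseJet γ Y k).IsSymm := by
  cases k with
  | zero => exact hγ
  | succ k => exact fun p v w ↦ congrArg (2 * ·) (hY k p v w)

end Ambient

section HypersurfaceForm

variable {F : Type*} [NormedAddCommGroup F] [NormedSpace ℝ F] {γ : F →L[ℝ] F →L[ℝ] ℝ}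
  {ℓ : F →L[ℝ] ℝ} {a : ℝ}

theorem blockForm_eq_hypersurfaceForm (v w : ℝ × F) :
    blockForm a ℓ γ v w = hypersurfaceForm γ ℓ a (v.2, v.1) (w.2, w.1) := by
  rw [blockForm_apply]
  simp [hypersurfaceForm]
  ring

theorem blockForm_nondegenerate (h : (hypersurfaceForm γ ℓ a).Nondegenerate) (v : ℝ × F)
    (hv : ∀ w, blockForm a ℓ γ v w = 0) : v = 0 := by
  have : (v.2, v.1) = 0 := h.1 _ fun w ↦ by
    simpa [blockForm_eq_hypersurfaceForm] using hv (w.2, w.1)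
  exact Prod.ext congr($(this).2) congr($(this).1)

/-- If the vector `(n, n2)` dual to `(0, 1)` has `n2 = 0`, then `n` is isotropic and non-zero. -/
theorem blockForm_isotropic {n : F × ℝ} (h : ∀ w, hypersurfaceForm γ ℓ a n w = w.2)
    (hn : n.2 = 0) : ((0, n.1) : ℝ × F) ≠ 0 ∧ blockForm a ℓ γ (0, n.1) (0, n.1) = 0 := by
  obtain ⟨n, m⟩ := n
  obtain rfl : m = 0 := hn
  refine ⟨fun h0 ↦ ?_, ?_⟩
  · have h1 := h (0, 1)
    obtain rfl : n = 0 := congr($(h0).2)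
    simp [hypersurfaceForm] at h1
  · rw [blockForm_eq_hypersurfaceForm]
    exact h (n, 0)

end HypersurfaceForm

theorem mainTheorem4 {E : Type u} [NormedAddCommGroup E] [NormedSpace ℝ E]
    [FiniteDimensional ℝ E]
    {H : Type v} [TopologicalSpace H] [ChartedSpace E H] [IsManifold 𝓘(ℝ, E) ∞ H]
    [T2Space H] [SecondCountableTopology H] [ConnectedSpace H]
    (D : MetricHypersurfaceData E H) (hD : D.IsNull)
    (Y : ℕ → Tensor02 E H) (hY : ∀ k, 1 ≤ k → (Y k).IsSmooth ∧ (Y k).IsSymm) :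
    ∃ (M : Type v) (_ : TopologicalSpace M) (_ : ChartedSpace (ℝ × E) M)
      (_ : IsManifold 𝓘(ℝ, ℝ × E) ∞ M) (_ : T2Space M) (_ : SecondCountableTopology M)
      (_ : ConnectedSpace M) (g : Tensor02 (ℝ × E) M) (p q : ℕ)
      (Φ : H → M) (ξ : VectField (ℝ × E) M),
      0 < p ∧ 0 < q ∧ IsSemiRiemannianMetric g p q ∧
      D.IsEmbeddedIn g Φ ξ ∧
      IsGeodesicField g ξ ∧
      ∀ k, 1 ≤ k → ∀ x v w,
        (1 / 2 : ℝ) * pullback02 Φ ((lieDeriv ξ)^[k] g) x v w = Y k x v w := by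
  obtain ⟨S, hS, hSZ, hSsymm⟩ := exists_family_iteratedDeriv_eq (transverseJet D.γ Y)
    (transverseJet_isSmooth D.γ_smooth fun k ↦ (hY (k + 1) (by lia)).1)
  have hSs := hSsymm (transverseJet_isSymm D.γ_symm fun k ↦ (hY (k + 1) (by lia)).2)
  -- the derivative of order `0`
  have hS0 : ∀ p v w, S 0 p v w = D.γ p v w := fun p v w ↦
    (congrFun iteratedDeriv_zero 0).symm.trans (hSZ 0 p v w)
  let B := riggedFamily D.ℓ2 D.ℓ S
  have hB : SmoothFamily B := smoothFamily_riggedFamily D.ℓ2_smooth D.ℓ_smooth hS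
  have hBs : ∀ r p v w, B r p v w = B r p w v := fun r p v w ↦
    blockForm_symm (hSs r p) v w
  have hB0 : ∀ p, B 0 p = blockForm (E := E) (D.ℓ2 p) (D.ℓ p) (D.γ p) :=
      fun p ↦ by
    have : S 0 p = (D.γ p : E →L[ℝ] E →L[ℝ] ℝ) :=
      ContinuousLinearMap.ext fun v ↦ ContinuousLinearMap.ext fun w ↦ hS0 p v w
    simp only [B, riggedFamily, this, zero_div, zero_smul, add_zero]
  have hn0 : ∀ p v, (∀ w, B 0 p v w = 0) → v = 0 := fun p v hv ↦ by
    rw [hB0] at hv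
    exact blockForm_nondegenerate (F := E) (D.nondegenerate p) v hv
  -- the ambient manifold
  obtain ⟨U, hU, hUc, hUn⟩ := hB.exists_opens hn0
  obtain ⟨p⟩ := (inferInstance : Nonempty H)
  have hg := hB.isSemiRiemannianMetric hBs hU hUn p
  have hsharp : ∀ w : E × ℝ, hypersurfaceForm (F := E) (D.γ p) (D.ℓ p) (D.ℓ2 p) (D.sharpOne p) w =
      w.2 := fun w ↦ LinearMap.BilinForm.apply_toDual_symm_apply
        (hB := D.nondegenerate p) (LinearMap.snd ℝ (TangentSpace 𝓘(ℝ, E) p) ℝ) w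
  -- the null vector of the data makes the metric indefinite
  have hiso := blockForm_isotropic (F := E) hsharp (hD p)
  have hpq := sig_pos_of_isotropic (hBs 0 p) (hn0 p) hiso.1 (by rw [hB0]; exact hiso.2)
  have hmf : ∀ (p : H) (v : TangentSpace 𝓘(ℝ, E) p),
      mfderiv 𝓘(ℝ, E) 𝓘(ℝ, ℝ × E) (Cylinder.zeroSection hU) p v = ((0, v) : ℝ × E) := fun p v ↦
    congr($((Cylinder.hasMFDerivAt_zeroSection hU p).mfderiv) v)
  refine ⟨U, inferInstance, inferInstance, inferInstance, inferInstance, inferInstance, hUc,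
    familyTensor U B, _, _, Cylinder.zeroSection hU, radialField E U, hpq.1, hpq.2, hg, ?_,
    familyTensor_riggedFamily_isGeodesicField hU D.ℓ2_smooth hB hg, ?_⟩
  · exact
      { embedding := Cylinder.isSmoothEmbedding_zeroSection hU
        rigging_smooth := radialField_isSmooth
        transversal := by
          rintro p ⟨v, hv⟩
          have h1 := (hmf p v).symm.trans hv
          exact zero_ne_one (congrArg Prod.fst h1)
        pullback_metric := fun p v w ↦ by
          rw [pullback02, hmf, hmf]
          exact (riggedFamily_apply_zero_zero (E := E) 0 p v w).trans (hS0 p v w)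
        pullback_one_form := fun p v ↦ by
          rw [hmf]
          refine (riggedFamily_apply_one_zero (E := E) 0 p (0, v)).trans ?_
          simp
        pullback_function := fun p ↦ blockForm_apply_one_zero_one_zero _ _ _ }
  · intro k hk p v w
    obtain ⟨k, rfl⟩ := Nat.exists_eq_add_of_le' hk
    rw [pullback02, hmf, hmf, lieDeriv_iterate_familyTensor hB hU]
    have h1 := familyDeriv_iterate_apply hB (k + 1) 0 p ((0, v) : ℝ × E) ((0, w) : ℝ × E)
    have h2 : (fun r ↦ B r p ((0, v) : ℝ × E) ((0, w) : ℝ × E)) = fun r ↦ S r p v w :=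
      funext fun r ↦ riggedFamily_apply_zero_zero (E := E) r p v w
    rw [h2] at h1
    refine (congrArg ((1 / 2 : ℝ) * ·) (h1.trans (hSZ (k + 1) p v w))).trans ?_
    change (1 / 2 : ℝ) * (2 * Y (k + 1) p v w) = _
    ring
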